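/- Let $\mathbb{k}$ be a field, $n\in\mathbb{N}=\{0,1,2,\dots\}$, $S=\mathbb{k}[x_0,\dots,x_n]$ with its standard grading, $\mathfrak{m}=\langle x_0,\dots,x_n\rangle$, and let $a\in\mathbb{Z}$ satisfy $a\ge -n$. Let $V_{n,a}$ be the finite-dimensional $\mathbb{Q}$-vector space of all $h\colon\mathbb{N}\to\mathbb{Q}$ such that $$\sum_{j\ge 0}h(j)t^j=\frac{b_0+b_1t+\dots+b_{a+n}t^{a+n}}{(1-t)^n}$$ for some $b_0,\dots,b_{a+n}\in\mathbb{Q}$, with its usual topology. For each $h\in V_{n,a}$ there is a unique polynomial $q_h\in\mathbb{Q}[s]$, the Hilbert polynomial of $h$, with $q_h(j)=h(j)$ for all $j\in\mathbb{N}$ with $j>a$; its degree is at most $n-1$ (and $q_h=0$ if $n=0$). Let $Q_{n,a}$ be the closed convex hull in $V_{n,a}$ of those elements of $V_{n,a}$ that are Hilbert functions $j\mapsto\dim_{\mathbb{k}}M_j$ of finitely generated $\mathbb{N}$-graded $S$-modules $M$ that are generated in degree zero and have no free summands. Let $T$ be the linear operator $T[h](j)=(n+j+1)h(j)-(j+1)h(j+1)$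 on $\mathbb{Q}^{\mathbb{N}}$; a power series is identified with its coefficient sequence. For a weakly decreasing sequence $\lambda=(\lambda_1\ge\dots\ge\lambda_r\ge 0)$ of non-negative integers (a partition with $r\ge 0$ parts, where zero parts are allowed and counted) put $$p_\lambda(s)=\prod_{i=1}^{r}(s-\lambda_{r-i+1}-2i+2)(s-\lambda_{r-i+1}-2i+1),$$ and let $\hat a=a+\max(1,-a)$. Then: 1. $Q_{n,a}$ is the set of all $h\in V_{n,a}$ satisfying $(n+j+1)h(j)\ge (j+1)h(j+1)$ for all $j\in\mathbb{N}$, together with the limiting inequality that the coefficient of $s^{n-1}$ in $q_h$ is non-negative (for $n=0$ this condition is empty, as $q_h=0$). Moreover, for $h\in Q_{n,a}$ with $q_h\ne 0$ the leading coefficient of $q_h$ is positive. 2. The Hilbert function of $S/\mathfrak{m}^i$ lies in $V_{n,a}$ for $1\le i\le a+1$, and each of the power series $$\sum_{j\ge\hat a}\Bigl(p_\lambda(j-\hat a)\prod_{\ell=1}^{\hat a-a-1}(j+\ell)\Bigr)t^j,\qquad \sum_{j\ge\hat a}\Bigl((j-\hat a)\,p_\mu(j-\hat a-1)\prod_{\ell=1}^{\hat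 a-a-1}(j+\ell)\Bigr)t^j,$$ where $\lambda$ ranges over all partitions with at most $\lfloor (n-\hat a+a)/2\rfloor$ parts and $\mu$ over all partitions with at most $\lfloor (n-\hat a+a-1)/2\rfloor$ parts (none if the bound is negative), has exactly one inverse image under $T$ in $V_{n,a}$. The extreme rays of the cone $Q_{n,a}$ are exactly the rays generated by the Hilbert functions of $S/\mathfrak{m}^i$ for $1\le i\le a+1$ and by the inverse images in $V_{n,a}$ under $T$ of these power series. -/

import Mathlib

open Polynomial

universe u

namespace HilbertCone

noncomputable section

/-! ### Graded modules over the polynomial ring and their Hilbert functions -/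

/-- The standard graded polynomial ring `S = 𝕜[x₀, …, xₙ]`. -/
abbrev PolyRing (𝕜 : Type u) [Field 𝕜] (n : ℕ) : Type u := MvPolynomial (Fin (n + 1)) 𝕜

/-- The homogeneous maximal ideal `⟨x₀, …, xₙ⟩`. -/
def irrelevantIdeal (𝕜 : Type u) [Field 𝕜] (n : ℕ) : Ideal (PolyRing 𝕜 n) :=
  Ideal.span (Set.range MvPolynomial.X)

/-- `ℳ` is an `ℕ`-grading of the `S`-module `M` (for the standard grading of `S`):
`M = ⨁ ℳ j` and `Sᵢ ℳⱼ ⊆ ℳᵢ₊ⱼ`. -/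
structure IsModuleGrading {𝕜 : Type u} [Field 𝕜] {n : ℕ} {M : Type u} [AddCommGroup M]
    [Module 𝕜 M] [Module (PolyRing 𝕜 n) M] (ℳ : ℕ → Submodule 𝕜 M) : Prop where
  isInternal : DirectSum.IsInternal ℳ
  smul_mem : ∀ (i j : ℕ) (f : PolyRing 𝕜 n) (m : M),
    f ∈ MvPolynomial.homogeneousSubmodule (Fin (n + 1)) 𝕜 i → m ∈ ℳ j → f • m ∈ ℳ (i + j)

/-- `M` has no nonzero free direct summand. -/
def NoFreeSummand (R : Type u) [CommRing R] (M : Type u) [AddCommGroup M] [Module R M] : Prop :=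
  ∀ N N' : Submodule R M, IsCompl N N' → Module.Free R N → N = ⊥

/-- The Hilbert function `j ↦ dim_𝕜 ℳⱼ`, as a rational sequence. -/
def hilbertFun {𝕜 : Type u} [Field 𝕜] {M : Type u} [AddCommGroup M] [Module 𝕜 M]
    (ℳ : ℕ → Submodule 𝕜 M) : ℕ → ℚ :=
  fun j => (Module.finrank 𝕜 (ℳ j) : ℚ)

/-- `h` is the Hilbert function of a finitely generated `ℕ`-graded `S`-module that is generated in
degree zero and has no free summands. -/
def IsHilbertFunction (𝕜 : Type u) [Field 𝕜] (n : ℕ) (h : ℕ → ℚ) : Prop :=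
  ∃ (M : Type u) (_ : AddCommGroup M) (_ : Module 𝕜 M) (_ : Module (PolyRing 𝕜 n) M)
    (_ : IsScalarTower 𝕜 (PolyRing 𝕜 n) M) (ℳ : ℕ → Submodule 𝕜 M),
    IsModuleGrading (n := n) ℳ ∧
    Module.Finite (PolyRing 𝕜 n) M ∧
    Submodule.span (PolyRing 𝕜 n) (ℳ 0 : Set M) = ⊤ ∧
    NoFreeSummand (PolyRing 𝕜 n) M ∧
    h = hilbertFun ℳ

/-- The grading of `S/I` by the images of the homogeneous parts of `S`. -/
def quotientGrading {𝕜 : Type u} [Field 𝕜] {n : ℕ} (I : Ideal (PolyRing 𝕜 n)) :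
    ℕ → Submodule 𝕜 (PolyRing 𝕜 n ⧸ I) :=
  fun j => (MvPolynomial.homogeneousSubmodule (Fin (n + 1)) 𝕜 j).map
    (Ideal.Quotient.mkₐ 𝕜 I).toLinearMap

/-- The Hilbert function of the cyclic module `S/⟨x₀, …, xₙ⟩ⁱ`. -/
def hilbertFunPower (𝕜 : Type u) [Field 𝕜] (n i : ℕ) : ℕ → ℚ :=
  hilbertFun (quotientGrading ((irrelevantIdeal 𝕜 n) ^ i))

/-! ### The ambient space, the cone and the operator `T` -/

/-- The space `V_{n,a}` of all `h : ℕ → ℚ` with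
`∑ h(j) tʲ = (b₀ + b₁ t + ⋯ + b_{a+n} t^{a+n}) / (1 - t)ⁿ` for some rational `b₀, …, b_{a+n}`.
It carries the topology induced by the product topology of `ℕ → ℚ`, which is its usual topology as
a finite-dimensional `ℚ`-vector space (the values at `0, …, a + n` are linear coordinates and every
other value is a fixed linear combination of them). -/
def V (n : ℕ) (a : ℤ) : Submodule ℚ (ℕ → ℚ) where
  carrier := {h | ∃ B ∈ Polynomial.degreeLT ℚ (a + n + 1).toNat,
    PowerSeries.mk h * (1 - PowerSeries.X) ^ n = (B : PowerSeries ℚ)}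
  zero_mem' := by
    refine ⟨0, Submodule.zero_mem _, ?_⟩
    have : PowerSeries.mk (0 : ℕ → ℚ) = 0 := by ext; simp
    simp [this]
  add_mem' := by
    rintro h h' ⟨B, hB, e⟩ ⟨B', hB', e'⟩
    refine ⟨B + B', Submodule.add_mem _ hB hB', ?_⟩
    have : PowerSeries.mk (h + h') = PowerSeries.mk h + PowerSeries.mk h' := by ext; simp
    rw [this, add_mul, e, e', Polynomial.coe_add]
  smul_mem' := by
    rintro c h ⟨B, hB, e⟩
    refine ⟨c • B, Submodule.smul_mem _ c hB, ?_⟩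
    have : PowerSeries.mk (c • h) = c • PowerSeries.mk h := by ext; simp
    rw [this, smul_mul_assoc, e, Polynomial.coe_smul]

/-- The cone `Q_{n,a}`: the closed convex hull in `V_{n,a}` of the Hilbert functions (lying in
`V_{n,a}`) of finitely generated `ℕ`-graded `S`-modules that are generated in degree zero and have
no free summands. -/
def Q (𝕜 : Type u) [Field 𝕜] (n : ℕ) (a : ℤ) : Set (V n a) :=
  closedConvexHull ℚ {h : V n a | IsHilbertFunction 𝕜 n (h : ℕ → ℚ)}

/-- The linear operator `T[h](j) = (n + j + 1) h(j) - (j + 1) h(j + 1)`. -/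
def T (n : ℕ) : (ℕ → ℚ) →ₗ[ℚ] (ℕ → ℚ) where
  toFun h := fun j => ((n : ℚ) + j + 1) * h j - ((j : ℚ) + 1) * h (j + 1)
  map_add' h h' := by ext j; simp only [Pi.add_apply]; ring
  map_smul' c h := by ext j; simp only [Pi.smul_apply, smul_eq_mul, RingHom.id_apply]; ring

/-- `q` is the Hilbert polynomial of `h ∈ V_{n,a}`: `q(j) = h(j)` for all `j ∈ ℕ` with `j > a`.
It is unique, as it is determined by its values at infinitely many points. -/
def IsHilbertPoly (a : ℤ) (h : ℕ → ℚ) (q : ℚ[X]) : Prop :=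
  ∀ j : ℕ, a < (j : ℤ) → q.eval (j : ℚ) = h j

/-! ### Extreme rays -/

section Rays

variable {E : Type*} [AddCommGroup E] [Module ℚ E]

/-- The ray generated by `v`. -/
def ray (v : E) : Set E := {x | ∃ c : ℚ, 0 ≤ c ∧ x = c • v}

/-- `R` is an extreme ray of `C`: it is a ray generated by a nonzero vector and an extreme
subset of `C`. -/
def IsExtremeRay (C R : Set E) : Prop :=
  (∃ v : E, v ≠ 0 ∧ R = ray v) ∧ IsExtreme ℚ C R

end Rays

/-! ### The explicit power series

A partition `λ = (λ₁ ≥ ⋯ ≥ λᵣ ≥ 0)` with `r` parts (zero parts are allowed and are counted) is an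
antitone function `Fin r → ℕ`. -/

/-- `p_λ(s) = ∏_{i=1}^r (s - λ_{r-i+1} - 2i + 2)(s - λ_{r-i+1} - 2i + 1)`; below, `i` runs from
`0` to `r - 1`, and `Fin.rev i` is the zero-based index of the part `λ_{r-i}`. -/
def p {r : ℕ} (lam : Fin r → ℕ) : ℤ[X] :=
  ∏ i : Fin r, (X - C ((lam i.rev : ℤ) + 2 * (i : ℤ))) * (X - C ((lam i.rev : ℤ) + 2 * (i : ℤ) + 1))

/-- `â = a + max(1, -a)`. -/
def aHat (a : ℤ) : ℤ := a + max 1 (-a)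

/-- The coefficients of the power series
`∑_{j ≥ â} (p_λ(j - â) ∏_{ℓ=1}^{â-a-1} (j + ℓ)) tʲ`. -/
def seriesEven (a : ℤ) {r : ℕ} (lam : Fin r → ℕ) : ℕ → ℚ := fun j =>
  if aHat a ≤ (j : ℤ) then
    (((p lam).eval ((j : ℤ) - aHat a) * ∏ l ∈ Finset.Icc 1 (aHat a - a - 1), ((j : ℤ) + l) : ℤ) : ℚ)
  else 0

/-- The coefficients of the power series
`∑_{j ≥ â} ((j - â) p_μ(j - â - 1) ∏_{ℓ=1}^{â-a-1} (j + ℓ)) tʲ`. -/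
def seriesOdd (a : ℤ) {r : ℕ} (mu : Fin r → ℕ) : ℕ → ℚ := fun j =>
  if aHat a ≤ (j : ℤ) then
    ((((j : ℤ) - aHat a) * (p mu).eval ((j : ℤ) - aHat a - 1) *
      ∏ l ∈ Finset.Icc 1 (aHat a - a - 1), ((j : ℤ) + l) : ℤ) : ℚ)
  else 0

/-- The explicit power series: those of all partitions `λ` with at most
`⌊(n - â + a)/2⌋` parts and of all partitions `μ` with at most `⌊(n - â + a - 1)/2⌋` parts (there
are none if the bound is negative; `/` on `ℤ` with divisor `2` is the floor). -/
def explicitSeries (n : ℕ) (a : ℤ) : Set (ℕ → ℚ) :=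
  {F | ∃ (r : ℕ) (lam : Fin r → ℕ), Antitone lam ∧ (r : ℤ) ≤ (n - aHat a + a) / 2 ∧
      F = seriesEven a lam} ∪
  {F | ∃ (r : ℕ) (mu : Fin r → ℕ), Antitone mu ∧ (r : ℤ) ≤ (n - aHat a + a - 1) / 2 ∧
      F = seriesOdd a mu}

/-- The listed generators of rays in `V_{n,a}`: the Hilbert functions of `S/⟨x₀, …, xₙ⟩ⁱ` for
`1 ≤ i ≤ a + 1`, and the inverse images in `V_{n,a}` under `T` of the explicit series. -/
def rayGenerators (𝕜 : Type u) [Field 𝕜] (n : ℕ) (a : ℤ) : Set (V n a) :=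
  {g | ∃ i : ℕ, 1 ≤ i ∧ (i : ℤ) ≤ a + 1 ∧ (g : ℕ → ℚ) = hilbertFunPower 𝕜 n i} ∪
  {g | T n (g : ℕ → ℚ) ∈ explicitSeries n a}

end

end HilbertCone

/-!
Put `f = T[h]`. Everything is expressed through the two facts that `T` is a bijection of `V_{n,a}`
(`existsUnique_T_eq`) and that `Q_{n,a}` is the cone of all `h` with `T[h] ≥ 0` (`Q_eq_cone`).

*The space.* Extend `h` to `ℤ` by zero. Multiplication of the generating series by `(1 - t)ⁿ` takes
`n`-fold differences, so `h ∈ V_{n,a}` if and only if `h` agrees on all integers `> a` with a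
polynomial of degree `< n` (`mem_V_iff`). On such polynomials `T` multiplies the leading coefficient
in degree `d` by `n - d > 0` (`coeff_tPoly`). Hence `T` is injective on `V_{n,a}`, which is
finite-dimensional, and it preserves `V_{n,a}`. Moreover `T[h] ≥ 0` forces the leading coefficient
of the Hilbert polynomial to be positive, and the limiting inequality is redundant
(`cone_eq_inter`).

*Hilbert functions satisfy the inequalities.* With respect to a monomial order, the standard
monomials of a module generated in degree zero form a basis and an order ideal `B`. Counting the
pairs of a monomial of degree `j + 1` in `B` and a variable dividing it, weighted by the exponent of
that variable, gives `(j + 1) |B_{j+1}| ≤ (n + j + 1) |B_j|` (`countMon_deficiency`,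
`IsHilbertFunction.deficiency_nonneg`).

*The inequalities suffice.* For `S/⟨x₀, …, x_{c-1}⟩^(J+1)` with `1 ≤ c ≤ n` the same count shows that
`T` of the Hilbert function is a positive multiple of `j ↦ C(j - J + n - c, n - c)` for `j ≥ J` and
zero below; for `c = n + 1` it is concentrated in degree `J`. Given `h` with `T[h] ≥ 0`, the
polynomial that describes `T[h]` in large degrees is, far out, a non-negative combination of these
binomial coefficients (`exists_binomial_expansion`). So a multiple of `h` is already the Hilbert
function of a direct sum of such quotients
(`exists_isTorsionHilbertFunction_of_mem_cone`), although the summands themselves need not have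
Hilbert functions in `V_{n,a}`.

*Extreme rays.* Below `â` the values of `T[h]` are unconstrained, which accounts for the `S/𝔪^i`.
From `â` on, `T[h]` is a fixed positive weight times a polynomial `R` in `s = j - â` of degree at
most `n - â + a` that is non-negative on `ℕ`. If `0 ≤ R ≤ K p` for an explicit polynomial `p`, then
`R` vanishes at the simple zeros of `p` and has at most its degree, so it is a multiple of `p`; this
gives extremality (`mem_ray_of_T_le`). Conversely, the intermediate value theorem shows that the
natural zeros of `R`, completed to pairs of consecutive numbers (apart from an initial run starting
at `0`), are no more numerous than the roots of `R`, so that some explicit polynomial of degree at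
most `deg R` vanishes at them (`exists_partition_of_eval_nonneg`). A small positive multiple of it
can be subtracted from `R` (`exists_pos_mul_le`), and an extreme ray is therefore a listed one
(`isExtremeRay_iff`).
-/

namespace HilbertCone

noncomputable section

/-! ### Counting monomials in order ideals -/

open scoped Classical in
/-- The number of degree `j` monomials in `x₀, …, xₙ` (encoded by their exponent vectors) that
satisfy `B`. -/
def countMon {n : ℕ} (B : (Fin (n + 1) →₀ ℕ) → Prop) (j : ℕ) : ℚ :=
  (((Finset.univ.finsuppAntidiag j : Finset (Fin (n + 1) →₀ ℕ)).filter B).card : ℚ)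

lemma sum_add_single_one {n : ℕ} (α : Fin (n + 1) →₀ ℕ) (i : Fin (n + 1)) :
    ∑ k, (α + Finsupp.single i 1 : Fin (n + 1) →₀ ℕ) k = ∑ k, α k + 1 := by
  simp [Finset.sum_add_distrib, Finsupp.single_apply]

open scoped Classical in
/-- Double counting of the pairs `(α, i)` with `x^α xᵢ` in `B`, each weighted by the exponent of
`xᵢ` in the product. -/
lemma sum_weight_succ {n : ℕ} (B : (Fin (n + 1) →₀ ℕ) → Prop) (j : ℕ) (i : Fin (n + 1)) :
    ∑ α ∈ (Finset.univ.finsuppAntidiag (j + 1) : Finset (Fin (n + 1) →₀ ℕ)).filter B, (α i : ℚ) =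
    ∑ α ∈ (Finset.univ.finsuppAntidiag j : Finset (Fin (n + 1) →₀ ℕ)).filter
      (fun α => B (α + Finsupp.single i 1)), ((α i : ℚ) + 1) := by
  have himg : (((Finset.univ.finsuppAntidiag (j + 1) : Finset (Fin (n + 1) →₀ ℕ)).filter B).filter
      (fun α => α i ≠ 0)) = ((Finset.univ.finsuppAntidiag j : Finset (Fin (n + 1) →₀ ℕ)).filter
      (fun α => B (α + Finsupp.single i 1))).image (fun α => α + Finsupp.single i 1) := by
    ext β
    simp only [Finset.mem_filter, Finset.mem_finsuppAntidiag, Finset.mem_image,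
      Finset.subset_univ, and_true]
    constructor
    · rintro ⟨⟨hs, hB⟩, hi⟩
      have hle : Finsupp.single i 1 ≤ β := by
        rw [Finsupp.single_le_iff]; omega
      obtain ⟨γ, rfl⟩ := exists_add_of_le hle
      rw [add_comm (Finsupp.single i 1) γ] at hs hB
      refine ⟨γ, ⟨?_, hB⟩, add_comm _ _⟩
      rw [sum_add_single_one] at hs
      exact Nat.succ_injective hs
    · rintro ⟨γ, ⟨hs, hB⟩, rfl⟩
      exact ⟨⟨by rw [sum_add_single_one, hs], hB⟩, by simp⟩
  have h1 : ∑ α ∈ (Finset.univ.finsuppAntidiag (j + 1) : Finset (Fin (n + 1) →₀ ℕ)).filter B,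
      (α i : ℚ) = ∑ α ∈ (((Finset.univ.finsuppAntidiag (j + 1) :
        Finset (Fin (n + 1) →₀ ℕ)).filter B).filter (fun α => α i ≠ 0)), (α i : ℚ) := by
    refine (Finset.sum_filter_of_ne fun x _ hx => ?_).symm
    exact fun h0 => hx (by simp [h0])
  rw [h1, himg, Finset.sum_image (by intro x _ y _ h; exact add_right_cancel h)]
  exact Finset.sum_congr rfl fun α _ => by simp

open scoped Classical in
/-- For an order ideal `B` of monomials, the deficiency `(n+j+1)|B_j| - (j+1)|B_{j+1}|` counts with
weights the ways to leave `B` from `B_j` by multiplication with a variable. -/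
lemma countMon_deficiency {n : ℕ} (B : (Fin (n + 1) →₀ ℕ) → Prop)
    (hB : ∀ α i, B (α + Finsupp.single i 1) → B α) (j : ℕ) :
    ((n : ℚ) + j + 1) * countMon B j - ((j : ℚ) + 1) * countMon B (j + 1) =
      ∑ α ∈ (Finset.univ.finsuppAntidiag j : Finset (Fin (n + 1) →₀ ℕ)).filter B,
        ∑ i, if B (α + Finsupp.single i 1) then (0 : ℚ) else (α i : ℚ) + 1 := by
  set A : ℕ → Finset (Fin (n + 1) →₀ ℕ) := fun j => Finset.univ.finsuppAntidiag j with hA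
  have hdeg : ∀ j, ∀ α ∈ A j, ∑ i, (α i : ℚ) = j := by
    intro j α hα
    simp only [hA, Finset.mem_finsuppAntidiag] at hα
    rw [← hα.1]; push_cast; rfl
  have e1 : ((j : ℚ) + 1) * countMon B (j + 1) =
      ∑ α ∈ (A j).filter B, ∑ i, if B (α + Finsupp.single i 1) then (α i : ℚ) + 1 else 0 := by
    have : ((j : ℚ) + 1) * countMon B (j + 1) = ∑ α ∈ (A (j + 1)).filter B, ∑ i, (α i : ℚ) := by
      rw [Finset.sum_congr rfl fun α hα => hdeg (j + 1) α (Finset.mem_filter.1 hα).1]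
      rw [Finset.sum_const, nsmul_eq_mul, countMon]
      push_cast
      ring
    rw [this, Finset.sum_comm, Finset.sum_comm (s := (A j).filter B)]
    refine Finset.sum_congr rfl fun i _ => ?_
    rw [sum_weight_succ, ← Finset.sum_filter, Finset.filter_filter]
    congr 1
    ext α
    simp only [Finset.mem_filter]
    exact ⟨fun h => ⟨h.1, hB _ _ h.2, h.2⟩, fun h => ⟨h.1, h.2.2⟩⟩
  have e2 : ((n : ℚ) + j + 1) * countMon B j = ∑ α ∈ (A j).filter B, ∑ i, ((α i : ℚ) + 1) := by
    rw [Finset.sum_congr rfl fun α hα => show ∑ i, ((α i : ℚ) + 1) = n + j + 1 by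
      rw [Finset.sum_add_distrib, hdeg j α (Finset.mem_filter.1 hα).1]; simp; ring]
    rw [Finset.sum_const, nsmul_eq_mul, countMon, mul_comm]
  rw [e1, e2, ← Finset.sum_sub_distrib]
  refine Finset.sum_congr rfl fun α _ => ?_
  rw [← Finset.sum_sub_distrib]
  refine Finset.sum_congr rfl fun i _ => ?_
  split_ifs <;> simp

lemma countMon_deficiency_nonneg {n : ℕ} (B : (Fin (n + 1) →₀ ℕ) → Prop)
    (hB : ∀ α i, B (α + Finsupp.single i 1) → B α) (j : ℕ) :
    0 ≤ ((n : ℚ) + j + 1) * countMon B j - ((j : ℚ) + 1) * countMon B (j + 1) := by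
  rw [countMon_deficiency B hB]
  refine Finset.sum_nonneg fun α _ => Finset.sum_nonneg fun i _ => ?_
  split_ifs
  · exact le_rfl
  · positivity

section Greedy

variable {K E ι : Type*} [Field K] [AddCommGroup E] [Module K E] [LinearOrder ι]

/-- The dimension of the span of a finite ordered family is the number of its members that are not
in the span of the earlier ones: these form a basis. -/
lemma finrank_span_eq_card_greedy (v : ι → E) (s : Finset ι) [DecidablePred fun i =>
      v i ∉ Submodule.span K (v '' {k | k ∈ s ∧ k < i})] :
    Module.finrank K (Submodule.span K (v '' (s : Set ι))) =
      (s.filter fun i => v i ∉ Submodule.span K (v '' {k | k ∈ s ∧ k < i})).card := by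
  classical
  have key : ∀ s : Finset ι,
      LinearIndepOn K v {i | i ∈ s ∧ v i ∉ Submodule.span K (v '' {k | k ∈ s ∧ k < i})} ∧
      Submodule.span K (v '' {i | i ∈ s ∧ v i ∉ Submodule.span K (v '' {k | k ∈ s ∧ k < i})}) =
        Submodule.span K (v '' (s : Set ι)) := by
    intro s
    induction s using Finset.induction_on_max with
    | empty => simp
    | insert a s has ih =>
      have hlow : ∀ i ∈ s, {k | k ∈ insert a s ∧ k < i} = {k | k ∈ s ∧ k < i} := by
        intro i hi
        ext k
        simp only [Set.mem_ofPred_eq, Finset.mem_insert]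
        constructor
        · rintro ⟨rfl | h, h'⟩
          · exact absurd (has i hi) (not_lt.2 h'.le)
          · exact ⟨h, h'⟩
        · rintro ⟨h, h'⟩; exact ⟨Or.inr h, h'⟩
      have hlowa : {k | k ∈ insert a s ∧ k < a} = (s : Set ι) := by
        ext k
        simp only [Set.mem_ofPred_eq, Finset.mem_insert, Finset.mem_coe]
        constructor
        · rintro ⟨rfl | h, h'⟩
          · exact absurd h' (lt_irrefl _)
          · exact h
        · intro h; exact ⟨Or.inr h, has k h⟩
      by_cases hmem : v a ∈ Submodule.span K (v '' (s : Set ι))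
      · have hset : {i | i ∈ insert a s ∧
            v i ∉ Submodule.span K (v '' {k | k ∈ insert a s ∧ k < i})} =
            {i | i ∈ s ∧ v i ∉ Submodule.span K (v '' {k | k ∈ s ∧ k < i})} := by
          ext i
          simp only [Set.mem_ofPred_eq]
          constructor
          · rintro ⟨hi, h⟩
            rcases Finset.mem_insert.1 hi with rfl | hi
            · rw [hlowa] at h; exact absurd hmem h
            · rw [hlow i hi] at h; exact ⟨hi, h⟩
          · rintro ⟨hi, h⟩
            exact ⟨Finset.mem_insert_of_mem hi, by rwa [hlow i hi]⟩
        rw [hset]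
        refine ⟨ih.1, ?_⟩
        rw [ih.2, Finset.coe_insert, Set.image_insert_eq, Submodule.span_insert_eq_span hmem]
      · have hset : {i | i ∈ insert a s ∧
            v i ∉ Submodule.span K (v '' {k | k ∈ insert a s ∧ k < i})} =
            insert a {i | i ∈ s ∧ v i ∉ Submodule.span K (v '' {k | k ∈ s ∧ k < i})} := by
          ext i
          simp only [Set.mem_ofPred_eq, Set.mem_insert_iff]
          constructor
          · rintro ⟨hi, h⟩
            rcases Finset.mem_insert.1 hi with rfl | hi
            · exact Or.inl rfl
            · rw [hlow i hi] at h; exact Or.inr ⟨hi, h⟩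
          · rintro (rfl | ⟨hi, h⟩)
            · exact ⟨Finset.mem_insert_self _ _, by rwa [hlowa]⟩
            · exact ⟨Finset.mem_insert_of_mem hi, by rwa [hlow i hi]⟩
        rw [hset]
        refine ⟨ih.1.insert (by rwa [ih.2]), ?_⟩
        rw [Set.image_insert_eq, Submodule.span_insert, ih.2, Finset.coe_insert,
          Set.image_insert_eq, Submodule.span_insert]
  obtain ⟨hli, hspan⟩ := key s
  have hcoe : {i | i ∈ s ∧ v i ∉ Submodule.span K (v '' {k | k ∈ s ∧ k < i})} =
      ((s.filter fun i => v i ∉ Submodule.span K (v '' {k | k ∈ s ∧ k < i}) : Finset ι) :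
        Set ι) := by
    ext; simp
  rw [← hspan, hcoe]
  rw [hcoe] at hli
  have := finrank_span_eq_card (R := K) (b := fun i : ((s.filter fun i =>
    v i ∉ Submodule.span K (v '' {k | k ∈ s ∧ k < i}) : Finset ι) : Set ι) => v i) hli
  rw [Set.image_eq_range, this]
  simp

end Greedy

/-! ### The growth of Hilbert functions of modules generated in degree zero -/

/-- Homogeneous projections witness that a spanning family of submodules is a direct sum
decomposition. -/
lemma isInternal_of_proj {K M : Type*} [Field K] [AddCommGroup M] [Module K M]
    (ℳ : ℕ → Submodule K M) (π : ℕ → M →ₗ[K] M) (h1 : ∀ j, ∀ m ∈ ℳ j, π j m = m)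
    (h2 : ∀ i j, i ≠ j → ∀ m ∈ ℳ i, π j m = 0) (htop : iSup ℳ = ⊤) :
    DirectSum.IsInternal ℳ := by
  refine (DirectSum.isInternal_submodule_iff_iSupIndep_and_iSup_eq_top ℳ).2 ⟨?_, htop⟩
  intro j
  rw [Submodule.disjoint_def]
  intro m hm hm'
  have hle : (⨆ i, ⨆ (_ : i ≠ j), ℳ i) ≤ LinearMap.ker (π j) :=
    iSup₂_le fun i hi x hx => h2 i j hi x hx
  rw [← h1 j m hm]
  exact hle hm'

lemma exists_proj_of_isInternal {K M : Type*} [Field K] [AddCommGroup M] [Module K M]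
    (ℳ : ℕ → Submodule K M) (h : DirectSum.IsInternal ℳ) :
    ∃ π : ℕ → M →ₗ[K] M, (∀ j, ∀ m ∈ ℳ j, π j m = m) ∧
      ∀ i j, i ≠ j → ∀ m ∈ ℳ i, π j m = 0 := by
  refine ⟨fun j => (ℳ j).subtype ∘ₗ (DirectSum.component K ℕ (fun i => ℳ i) j) ∘ₗ
    (LinearEquiv.ofBijective (DirectSum.coeLinearMap ℳ) h).symm.toLinearMap, ?_, ?_⟩
  · intro j m hm
    have := h.ofBijective_coeLinearMap_same ⟨m, hm⟩
    simp only [LinearMap.comp_apply, LinearEquiv.coe_coe,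
      Submodule.subtype_apply]
    exact congrArg Subtype.val this
  · intro i j hij m hm
    have := h.ofBijective_coeLinearMap_of_ne hij ⟨m, hm⟩
    simp only [LinearMap.comp_apply, LinearEquiv.coe_coe,
      Submodule.subtype_apply]
    exact congrArg Subtype.val this

/-- The graded pieces of a module generated in degree zero are spanned by the products of monomials
with the generators. -/
lemma gradedPiece_eq_span {𝕜 : Type u} [Field 𝕜] {n : ℕ} {M : Type u} [AddCommGroup M]
    [Module 𝕜 M] [Module (PolyRing 𝕜 n) M] [IsScalarTower 𝕜 (PolyRing 𝕜 n) M]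
    {ℳ : ℕ → Submodule 𝕜 M} (hℳ : IsModuleGrading (n := n) ℳ) {r : ℕ} (e : Fin r → M)
    (he : ∀ k, e k ∈ ℳ 0) (hspan : Submodule.span (PolyRing 𝕜 n) (Set.range e) = ⊤) (j : ℕ) :
    ℳ j = Submodule.span 𝕜 {m | ∃ (α : Fin (n + 1) →₀ ℕ) (k : Fin r), ∑ i, α i = j ∧
      m = (MvPolynomial.monomial α (1 : 𝕜) : PolyRing 𝕜 n) • e k} := by
  set G : ℕ → Submodule 𝕜 M := fun j => Submodule.span 𝕜
    {m | ∃ (α : Fin (n + 1) →₀ ℕ) (k : Fin r), ∑ i, α i = j ∧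
      m = (MvPolynomial.monomial α (1 : 𝕜) : PolyRing 𝕜 n) • e k} with hG
  have hle : ∀ j, G j ≤ ℳ j := by
    intro j
    refine Submodule.span_le.2 ?_
    rintro _ ⟨α, k, hα, rfl⟩
    have := hℳ.smul_mem j 0 (MvPolynomial.monomial α (1 : 𝕜)) (e k)
      (MvPolynomial.isHomogeneous_monomial 1 (by rw [Finsupp.degree_eq_sum, hα])) (he k)
    simpa using this
  have htop : ∀ m : M, m ∈ iSup G := by
    intro m
    have hm : m ∈ Submodule.span (PolyRing 𝕜 n) (Set.range e) := by rw [hspan]; trivial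
    induction hm using Submodule.span_induction with
    | mem x hx =>
      obtain ⟨k, rfl⟩ := hx
      refine Submodule.mem_iSup_of_mem 0 (Submodule.subset_span ⟨0, k, by simp, ?_⟩)
      simp
    | zero => exact zero_mem _
    | add x y _ _ hx hy => exact add_mem hx hy
    | smul f x _ hx =>
      induction f using MvPolynomial.induction_on' with
      | add p q hp hq => rw [add_smul]; exact add_mem hp hq
      | monomial β c =>
        have hle' : iSup G ≤ (iSup G).comap
            (Algebra.lsmul 𝕜 𝕜 M (MvPolynomial.monomial β c : PolyRing 𝕜 n)) := by
          refine iSup_le fun i => Submodule.span_le.2 ?_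
          rintro _ ⟨α, k, hα, rfl⟩
          show (MvPolynomial.monomial β c : PolyRing 𝕜 n) •
            (MvPolynomial.monomial α (1 : 𝕜) : PolyRing 𝕜 n) • e k ∈ iSup G
          rw [smul_smul, MvPolynomial.monomial_mul, mul_one, ← mul_one c, ← smul_eq_mul,
            ← MvPolynomial.smul_monomial, smul_assoc]
          refine Submodule.smul_mem _ _ (Submodule.mem_iSup_of_mem _
            (Submodule.subset_span ⟨β + α, k, rfl, rfl⟩))
        exact hle' hx
  refine le_antisymm ?_ (hle j)
  obtain ⟨π, h1, h2⟩ := exists_proj_of_isInternal ℳ hℳ.isInternal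
  have hπ : iSup G ≤ (G j).comap (π j) := by
    refine iSup_le fun i x hx => ?_
    by_cases hij : i = j
    · subst hij
      rw [Submodule.mem_comap, h1 _ _ (hle _ hx)]
      exact hx
    · rw [Submodule.mem_comap, h2 i j hij _ (hle _ hx)]
      exact zero_mem _
  intro m hm
  rw [← h1 j m hm]
  exact hπ (htop m)

/-- Let `v k α` be a family indexed by the monomials `x^α e_k` of a free module, on which
multiplication by the variables acts through linear maps. For the order by position, then
lexicographically, the monomials not in the span of smaller ones of the same degree form an order
ideal in each component, and they count the dimensions of the spans of the `v k α` of fixed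
degree. -/
lemma exists_standardMonomials {K E : Type*} [Field K] [AddCommGroup E] [Module K E] {n r : ℕ}
    (v : Fin r → (Fin (n + 1) →₀ ℕ) → E) (X : Fin (n + 1) → E →ₗ[K] E)
    (hv : ∀ k α i, v k (α + Finsupp.single i 1) = X i (v k α)) :
    ∃ B : Fin r → (Fin (n + 1) →₀ ℕ) → Prop,
      (∀ k α i, B k (α + Finsupp.single i 1) → B k α) ∧
      ∀ j, (Module.finrank K (Submodule.span K
        {m | ∃ (α : Fin (n + 1) →₀ ℕ) (k : Fin r), ∑ i, α i = j ∧ m = v k α}) : ℚ) =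
          ∑ k, countMon (B k) j := by
  classical
  let w : Fin r ×ₗ Lex (Fin (n + 1) →₀ ℕ) → E := fun q => v (ofLex q).1 (ofLex (ofLex q).2)
  let S : ℕ → Finset (Fin r ×ₗ Lex (Fin (n + 1) →₀ ℕ)) := fun j =>
    (Finset.univ ×ˢ (Finset.univ.finsuppAntidiag j : Finset (Fin (n + 1) →₀ ℕ))).image
      fun q => toLex (q.1, toLex q.2)
  have hinj : Function.Injective fun q : Fin r × (Fin (n + 1) →₀ ℕ) =>
      (toLex (q.1, toLex q.2) : Fin r ×ₗ Lex (Fin (n + 1) →₀ ℕ)) := by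
    rintro ⟨k, α⟩ ⟨l, β⟩ h
    have h' := Prod.mk.inj (toLex.injective h)
    exact Prod.ext h'.1 (toLex.injective h'.2)
  have hS : ∀ j q, q ∈ S j ↔ ∑ i, (ofLex (ofLex q).2 : Fin (n + 1) →₀ ℕ) i = j := by
    intro j q
    simp only [S, Finset.mem_image, Finset.mem_product, Finset.mem_univ, true_and,
      Finset.mem_finsuppAntidiag, Finset.subset_univ, and_true]
    constructor
    · rintro ⟨q, hq, rfl⟩
      exact hq
    · intro h; exact ⟨((ofLex q).1, ofLex (ofLex q).2), h, rfl⟩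
  have himage : ∀ j, {m | ∃ (α : Fin (n + 1) →₀ ℕ) (k : Fin r), ∑ i, α i = j ∧ m = v k α} =
      w '' (S j : Set (Fin r ×ₗ Lex (Fin (n + 1) →₀ ℕ))) := by
    intro j
    ext m
    constructor
    · rintro ⟨α, k, hα, rfl⟩
      exact ⟨toLex (k, toLex α), (hS j _).2 hα, rfl⟩
    · rintro ⟨q, hq, rfl⟩
      exact ⟨ofLex (ofLex q).2, (ofLex q).1, (hS j _).1 hq, rfl⟩
  refine ⟨fun k α => v k α ∉ Submodule.span K
    (w '' {q | q ∈ S (∑ i, α i) ∧ q < toLex (k, toLex α)}), ?_, ?_⟩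
  · intro k α i hk hmem
    apply hk
    rw [hv]
    have := Submodule.mem_map_of_mem (f := X i) hmem
    rw [Submodule.map_span] at this
    refine Submodule.span_mono ?_ this
    rintro _ ⟨_, ⟨q, ⟨hq, hlt⟩, rfl⟩, rfl⟩
    rw [hS] at hq
    refine ⟨toLex ((ofLex q).1, toLex (ofLex (ofLex q).2 + Finsupp.single i 1)), ⟨?_, ?_⟩,
      hv _ _ _⟩
    · rw [hS, sum_add_single_one]
      exact (sum_add_single_one _ _).trans (congrArg (· + 1) hq)
    · rw [Prod.Lex.lt_iff] at hlt ⊢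
      refine hlt.imp_right fun h => ⟨h.1, ?_⟩
      exact add_lt_add_left h.2 (toLex (Finsupp.single i 1))
  · intro j
    rw [himage, finrank_span_eq_card_greedy, Finset.filter_image,
      Finset.card_image_of_injective _ hinj, Finset.card_filter, Finset.sum_product]
    push_cast
    refine Finset.sum_congr rfl fun k _ => ?_
    rw [countMon, Finset.card_filter]
    push_cast
    refine Finset.sum_congr rfl fun α hα => ?_
    have : ∑ i, α i = j := (Finset.mem_finsuppAntidiag.1 hα).1
    rw [this]
    rfl

/-- Hilbert functions of modules generated in degree zero grow at most as fast as that of the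
polynomial ring: the standard monomials form a basis and an order ideal, so that
`countMon_deficiency_nonneg` applies. -/
lemma IsHilbertFunction.deficiency_nonneg {𝕜 : Type u} [Field 𝕜] {n : ℕ} {h : ℕ → ℚ}
    (hh : IsHilbertFunction 𝕜 n h) (j : ℕ) :
    0 ≤ ((n : ℚ) + j + 1) * h j - ((j : ℚ) + 1) * h (j + 1) := by
  obtain ⟨M, _, _, _, _, ℳ, hℳ, hfin, hgen, -, rfl⟩ := hh
  obtain ⟨s, hs, hspan⟩ := (Submodule.fg_span_iff_fg_span_finset_subset (R := PolyRing 𝕜 n)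
    (ℳ 0 : Set M)).1 (by rw [hgen]; exact hfin.fg_top)
  set e : Fin s.card → M := fun i => (s.equivFin.symm i : M) with he
  have he0 : ∀ k, e k ∈ ℳ 0 := fun k => hs (s.equivFin.symm k).2
  have hrange : Set.range e = s := by
    ext x
    constructor
    · rintro ⟨i, rfl⟩; exact (s.equivFin.symm i).2
    · intro hx; exact ⟨s.equivFin ⟨x, hx⟩, by simp [he]⟩
  have hetop : Submodule.span (PolyRing 𝕜 n) (Set.range e) = ⊤ := by
    rw [hrange, ← hspan, hgen]
  obtain ⟨B, hB, hcard⟩ := exists_standardMonomials (K := 𝕜) (n := n)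
    (fun k α => (MvPolynomial.monomial α (1 : 𝕜) : PolyRing 𝕜 n) • e k)
    (fun i => Algebra.lsmul 𝕜 𝕜 M (MvPolynomial.X i : PolyRing 𝕜 n)) (by
      intro k α i
      show _ = (MvPolynomial.X i : PolyRing 𝕜 n) •
        (MvPolynomial.monomial α (1 : 𝕜) : PolyRing 𝕜 n) • e k
      rw [smul_smul, MvPolynomial.X, MvPolynomial.monomial_mul,
        add_comm (Finsupp.single i 1) α, mul_one])
  have hcard' : ∀ j, hilbertFun ℳ j = ∑ k, countMon (B k) j := by
    intro j
    rw [hilbertFun, gradedPiece_eq_span hℳ e he0 hetop j]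
    exact hcard j
  rw [hcard', hcard', Finset.mul_sum, Finset.mul_sum, ← Finset.sum_sub_distrib]
  exact Finset.sum_nonneg fun k _ => countMon_deficiency_nonneg (B k) (hB k) j

/-! ### Monomial quotients and direct sums -/

lemma mem_restrictSupportIdeal_iff {𝕜 : Type u} [Field 𝕜] {n : ℕ}
    {s : Set (Fin (n + 1) →₀ ℕ)} (hs : IsUpperSet s) (f : PolyRing 𝕜 n) :
    f ∈ MvPolynomial.restrictSupportIdeal 𝕜 s hs ↔ ∀ α, f.coeff α ≠ 0 → α ∈ s := by
  rw [← Submodule.restrictScalars_mem 𝕜, MvPolynomial.restrictScalars_restrictSupportIdeal,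
    MvPolynomial.mem_restrictSupport_iff]
  simp [Set.subset_def]

/-- The quotient of the polynomial ring by a monomial ideal is graded. -/
lemma isModuleGrading_quotientGrading (𝕜 : Type u) [Field 𝕜] {n : ℕ}
    {s : Set (Fin (n + 1) →₀ ℕ)} (hs : IsUpperSet s) :
    IsModuleGrading (n := n) (quotientGrading (MvPolynomial.restrictSupportIdeal 𝕜 s hs)) := by
  set I := MvPolynomial.restrictSupportIdeal 𝕜 s hs with hI
  have hcomp : ∀ j, I.restrictScalars 𝕜 ≤
      (I.restrictScalars 𝕜).comap (MvPolynomial.homogeneousComponent (R := 𝕜) j) := by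
    intro j f hf
    rw [Submodule.mem_comap, Submodule.restrictScalars_mem, mem_restrictSupportIdeal_iff]
    rw [Submodule.restrictScalars_mem, mem_restrictSupportIdeal_iff] at hf
    intro α hα
    rw [MvPolynomial.coeff_homogeneousComponent] at hα
    exact hf α fun h => hα (by rw [h, ite_self])
  refine ⟨isInternal_of_proj _
    (fun j => Submodule.mapQ (I.restrictScalars 𝕜) (I.restrictScalars 𝕜) _ (hcomp j)) ?_ ?_ ?_, ?_⟩
  · rintro j _ ⟨f, hf, rfl⟩
    show Submodule.mapQ (I.restrictScalars 𝕜) (I.restrictScalars 𝕜) _ (hcomp j)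
      (Submodule.Quotient.mk f) = Submodule.Quotient.mk f
    rw [Submodule.mapQ_apply, MvPolynomial.homogeneousComponent_of_mem hf, if_pos rfl]
  · rintro i j hij _ ⟨f, hf, rfl⟩
    show Submodule.mapQ (I.restrictScalars 𝕜) (I.restrictScalars 𝕜) _ (hcomp j)
      (Submodule.Quotient.mk f) = 0
    rw [Submodule.mapQ_apply, MvPolynomial.homogeneousComponent_of_mem hf, if_neg hij.symm]
    rfl
  · rw [eq_top_iff]
    rintro m -
    obtain ⟨f, rfl⟩ := Ideal.Quotient.mk_surjective m
    rw [← MvPolynomial.sum_homogeneousComponent f, map_sum]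
    refine sum_mem fun i _ => Submodule.mem_iSup_of_mem i ?_
    exact ⟨_, MvPolynomial.homogeneousComponent_mem i f, rfl⟩
  · rintro i j f _ hf ⟨g, hg, rfl⟩
    exact ⟨f * g, MvPolynomial.IsHomogeneous.mul hf hg, rfl⟩

/-- The Hilbert function of the quotient by a monomial ideal counts the monomials outside it. -/
lemma hilbertFun_quotientGrading (𝕜 : Type u) [Field 𝕜] {n : ℕ}
    {s : Set (Fin (n + 1) →₀ ℕ)} (hs : IsUpperSet s) (j : ℕ) :
    hilbertFun (quotientGrading (MvPolynomial.restrictSupportIdeal 𝕜 s hs)) j =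
      countMon (· ∉ s) j := by
  classical
  set I := MvPolynomial.restrictSupportIdeal 𝕜 s hs with hI
  let F : Finset (Fin (n + 1) →₀ ℕ) := (Finset.univ.finsuppAntidiag j).filter (· ∉ s)
  let b : F → PolyRing 𝕜 n ⧸ I := fun α => Ideal.Quotient.mkₐ 𝕜 I (MvPolynomial.monomial α.1 1)
  have hspan : quotientGrading I j = Submodule.span 𝕜 (Set.range b) := by
    apply le_antisymm
    · rintro _ ⟨f, hf, rfl⟩
      have hf' : f.IsHomogeneous j := hf
      rw [AlgHom.toLinearMap_apply, f.as_sum, map_sum]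
      refine sum_mem fun α hα => ?_
      by_cases hαs : α ∈ s
      · have : MvPolynomial.monomial α (f.coeff α) ∈ I := by
          rw [mem_restrictSupportIdeal_iff]
          intro β hβ
          rw [MvPolynomial.coeff_monomial] at hβ
          by_cases h : α = β
          · exact h ▸ hαs
          · rw [if_neg h] at hβ; exact absurd rfl hβ
        have h0 : Ideal.Quotient.mkₐ 𝕜 I (MvPolynomial.monomial α (f.coeff α)) = 0 :=
          Ideal.Quotient.eq_zero_iff_mem.2 this
        rw [h0]
        exact zero_mem _
      · have hdeg : ∑ i, α i = j := by
          rw [← Finsupp.degree_eq_sum]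
          by_contra hne
          exact MvPolynomial.mem_support_iff.1 hα (hf'.coeff_eq_zero hne)
        have hαF : α ∈ F := by simp [F, hαs, hdeg]
        have : MvPolynomial.monomial α (f.coeff α) =
            f.coeff α • (MvPolynomial.monomial α 1 : PolyRing 𝕜 n) := by
          rw [MvPolynomial.smul_monomial, smul_eq_mul, mul_one]
        rw [this, map_smul]
        exact Submodule.smul_mem _ _ (Submodule.subset_span ⟨⟨α, hαF⟩, rfl⟩)
    · refine Submodule.span_le.2 ?_
      rintro _ ⟨⟨α, hα⟩, rfl⟩
      refine ⟨MvPolynomial.monomial α 1, MvPolynomial.isHomogeneous_monomial 1 ?_, rfl⟩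
      rw [Finsupp.degree_eq_sum]
      exact (Finset.mem_finsuppAntidiag.1 (Finset.mem_filter.1 hα).1).1
  have hli : LinearIndependent 𝕜 b := by
    rw [Fintype.linearIndependent_iff]
    intro c hc α
    have hmem : ∑ β : F, c β • (MvPolynomial.monomial β.1 1 : PolyRing 𝕜 n) ∈ I := by
      rw [← Ideal.Quotient.eq_zero_iff_mem, ← Ideal.Quotient.mkₐ_eq_mk 𝕜, map_sum, ← hc]
      exact Finset.sum_congr rfl fun β _ => map_smul _ _ _
    rw [mem_restrictSupportIdeal_iff] at hmem
    by_contra hne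
    refine (Finset.mem_filter.1 α.2).2 (hmem α.1 ?_)
    rw [MvPolynomial.coeff_sum, Finset.sum_eq_single α]
    · simpa using hne
    · intro β _ hβ
      rw [MvPolynomial.coeff_smul, MvPolynomial.coeff_monomial, if_neg, smul_zero]
      exact fun h => hβ (Subtype.ext h)
    · intro h; exact absurd (Finset.mem_univ _) h
  rw [hilbertFun, hspan, finrank_span_eq_card hli, countMon]
  simp only [Fintype.card_coe, F]
  congr!

/-- A module over a domain that is killed by a nonzero scalar has no free summands. -/
lemma noFreeSummand_of_torsion {R : Type u} [CommRing R] [IsDomain R] {M : Type u}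
    [AddCommGroup M] [Module R M] (f : R) (hf : f ≠ 0) (h : ∀ m : M, f • m = 0) :
    NoFreeSummand R M := by
  intro N _ _ hN
  rw [Submodule.eq_bot_iff]
  intro x hx
  obtain ⟨⟨ι, b⟩⟩ := hN.exists_basis
  have h0 : f • (⟨x, hx⟩ : N) = 0 := Subtype.ext (h x)
  have h1 : b.repr ⟨x, hx⟩ = 0 := by
    ext i
    have h2 : f * b.repr ⟨x, hx⟩ i = 0 := by
      rw [← smul_eq_mul, ← Finsupp.smul_apply, ← map_smul, h0, map_zero, Finsupp.zero_apply]
    exact (mul_eq_zero.1 h2).resolve_left hf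
  exact congrArg Subtype.val (b.repr.map_eq_zero_iff.1 h1)

/-- `h` is the Hilbert function of a finitely generated graded module that is generated in degree
zero and killed by a nonzero polynomial. Unlike the absence of free summands, this condition is
visibly stable under direct sums. -/
def IsTorsionHilbertFunction (𝕜 : Type u) [Field 𝕜] (n : ℕ) (h : ℕ → ℚ) : Prop :=
  ∃ (M : Type u) (_ : AddCommGroup M) (_ : Module 𝕜 M) (_ : Module (PolyRing 𝕜 n) M)
    (_ : IsScalarTower 𝕜 (PolyRing 𝕜 n) M) (ℳ : ℕ → Submodule 𝕜 M),
    IsModuleGrading (n := n) ℳ ∧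
    Module.Finite (PolyRing 𝕜 n) M ∧
    Submodule.span (PolyRing 𝕜 n) (ℳ 0 : Set M) = ⊤ ∧
    (∃ f : PolyRing 𝕜 n, f ≠ 0 ∧ ∀ m : M, f • m = 0) ∧
    (∀ j, Module.Finite 𝕜 (ℳ j)) ∧
    h = hilbertFun ℳ

lemma IsTorsionHilbertFunction.isHilbertFunction {𝕜 : Type u} [Field 𝕜] {n : ℕ} {h : ℕ → ℚ}
    (hh : IsTorsionHilbertFunction 𝕜 n h) : IsHilbertFunction 𝕜 n h := by
  obtain ⟨M, _, _, _, _, ℳ, hℳ, hfin, hgen, ⟨f, hf, hfm⟩, -, rfl⟩ := hh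
  exact ⟨M, _, _, _, ‹_›, ℳ, hℳ, hfin, hgen, noFreeSummand_of_torsion f hf hfm, rfl⟩

/-- Quotients by nonzero monomial ideals realize the counting functions of monomials. -/
lemma isTorsionHilbertFunction_countMon (𝕜 : Type u) [Field 𝕜] {n : ℕ}
    {s : Set (Fin (n + 1) →₀ ℕ)} (hs : IsUpperSet s) (hne : s.Nonempty) :
    IsTorsionHilbertFunction 𝕜 n (countMon (· ∉ s)) := by
  refine ⟨PolyRing 𝕜 n ⧸ MvPolynomial.restrictSupportIdeal 𝕜 s hs, inferInstance, inferInstance,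
    inferInstance, inferInstance, quotientGrading _, isModuleGrading_quotientGrading 𝕜 hs,
    inferInstance, ?_, ?_, ?_, ?_⟩
  · rw [eq_top_iff]
    rintro m -
    obtain ⟨f, rfl⟩ := Ideal.Quotient.mk_surjective m
    have h1 : (1 : PolyRing 𝕜 n ⧸ MvPolynomial.restrictSupportIdeal 𝕜 s hs) ∈
        quotientGrading (MvPolynomial.restrictSupportIdeal 𝕜 s hs) 0 :=
      ⟨1, MvPolynomial.isHomogeneous_one _ _, rfl⟩
    have := Submodule.smul_mem _ f (Submodule.subset_span (R := PolyRing 𝕜 n) h1)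
    change Ideal.Quotient.mk _ (f * 1) ∈ _ at this
    rwa [mul_one] at this
  · obtain ⟨α, hα⟩ := hne
    refine ⟨MvPolynomial.monomial α 1, by simp, fun m => ?_⟩
    obtain ⟨f, rfl⟩ := Ideal.Quotient.mk_surjective m
    change Ideal.Quotient.mk _ (MvPolynomial.monomial α (1 : 𝕜) * f) = 0
    have : Ideal.Quotient.mk (MvPolynomial.restrictSupportIdeal 𝕜 s hs)
        (MvPolynomial.monomial α (1 : 𝕜)) = 0 := by
      rw [Ideal.Quotient.eq_zero_iff_mem, mem_restrictSupportIdeal_iff]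
      intro β hβ
      rw [MvPolynomial.coeff_monomial] at hβ
      by_cases h : α = β
      · exact h ▸ hα
      · rw [if_neg h] at hβ; exact absurd rfl hβ
    rw [map_mul, this, zero_mul]
  · intro j
    have : Module.Finite 𝕜 (MvPolynomial.homogeneousSubmodule (Fin (n + 1)) 𝕜 j) :=
      Module.Finite.iff_fg.2 (MvPolynomial.homogeneousSubmodule_fg _ _ j)
    exact Module.Finite.map _ _
  · funext j
    exact (hilbertFun_quotientGrading 𝕜 hs j).symm

/-- The underlying space of a product of subspaces is the product of the underlying spaces. -/
def submoduleProdEquiv {K M M' : Type*} [Field K] [AddCommGroup M] [Module K M] [AddCommGroup M']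
    [Module K M'] (p : Submodule K M) (q : Submodule K M') : p.prod q ≃ₗ[K] p × q where
  toFun x := (⟨x.1.1, x.2.1⟩, ⟨x.1.2, x.2.2⟩)
  invFun x := ⟨(x.1.1, x.2.1), x.1.2, x.2.2⟩
  map_add' _ _ := rfl
  map_smul' _ _ := rfl
  left_inv _ := rfl
  right_inv _ := rfl

lemma IsTorsionHilbertFunction.add {𝕜 : Type u} [Field 𝕜] {n : ℕ} {h h' : ℕ → ℚ}
    (hh : IsTorsionHilbertFunction 𝕜 n h) (hh' : IsTorsionHilbertFunction 𝕜 n h') :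
    IsTorsionHilbertFunction 𝕜 n (h + h') := by
  obtain ⟨M, _, _, _, _, ℳ, hℳ, hfin, hgen, ⟨f, hf, hfm⟩, hfd, rfl⟩ := hh
  obtain ⟨M', _, _, _, _, ℳ', hℳ', hfin', hgen', ⟨f', hf', hfm'⟩, hfd', rfl⟩ := hh'
  refine ⟨M × M', inferInstance, inferInstance, inferInstance, inferInstance,
    fun j => (ℳ j).prod (ℳ' j), ⟨?_, ?_⟩, inferInstance, ?_, ⟨f * f', mul_ne_zero hf hf', ?_⟩,
    ?_, ?_⟩
  · obtain ⟨π, h1, h2⟩ := exists_proj_of_isInternal ℳ hℳ.isInternal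
    obtain ⟨π', h1', h2'⟩ := exists_proj_of_isInternal ℳ' hℳ'.isInternal
    refine isInternal_of_proj _ (fun j => (π j).prodMap (π' j)) ?_ ?_ ?_
    · rintro j ⟨m, m'⟩ ⟨hm, hm'⟩
      exact Prod.ext (h1 j m hm) (h1' j m' hm')
    · rintro i j hij ⟨m, m'⟩ ⟨hm, hm'⟩
      exact Prod.ext (h2 i j hij m hm) (h2' i j hij m' hm')
    · rw [eq_top_iff]
      rintro ⟨m, m'⟩ -
      have e1 : iSup ℳ ≤ (⨆ j, (ℳ j).prod (ℳ' j)).comap (LinearMap.inl 𝕜 M M') :=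
        iSup_le fun j x hx => Submodule.mem_iSup_of_mem j ⟨hx, zero_mem _⟩
      have e2 : iSup ℳ' ≤ (⨆ j, (ℳ j).prod (ℳ' j)).comap (LinearMap.inr 𝕜 M M') :=
        iSup_le fun j x hx => Submodule.mem_iSup_of_mem j ⟨zero_mem _, hx⟩
      rw [hℳ.isInternal.submodule_iSup_eq_top] at e1
      rw [hℳ'.isInternal.submodule_iSup_eq_top] at e2
      have : ((m, 0) : M × M') + (0, m') ∈ ⨆ j, (ℳ j).prod (ℳ' j) :=
        Submodule.add_mem _ (e1 (Submodule.mem_top (R := 𝕜) (x := m)))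
        (e2 (Submodule.mem_top (R := 𝕜) (x := m')))
      rwa [Prod.mk_add_mk, add_zero, zero_add] at this
  · rintro i j g ⟨m, m'⟩ hg ⟨hm, hm'⟩
    exact ⟨hℳ.smul_mem i j g m hg hm, hℳ'.smul_mem i j g m' hg hm'⟩
  · rw [eq_top_iff]
    rintro ⟨m, m'⟩ -
    have e1 : Submodule.span (PolyRing 𝕜 n) (ℳ 0 : Set M) ≤
        (Submodule.span (PolyRing 𝕜 n) (((ℳ 0).prod (ℳ' 0) : Submodule 𝕜 (M × M')) :
          Set (M × M'))).comap (LinearMap.inl (PolyRing 𝕜 n) M M') :=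
      Submodule.span_le.2 fun x hx => Submodule.subset_span ⟨hx, zero_mem _⟩
    have e2 : Submodule.span (PolyRing 𝕜 n) (ℳ' 0 : Set M') ≤
        (Submodule.span (PolyRing 𝕜 n) (((ℳ 0).prod (ℳ' 0) : Submodule 𝕜 (M × M')) :
          Set (M × M'))).comap (LinearMap.inr (PolyRing 𝕜 n) M M') :=
      Submodule.span_le.2 fun x hx => Submodule.subset_span ⟨zero_mem _, hx⟩
    rw [hgen] at e1
    rw [hgen'] at e2
    have : ((m, 0) : M × M') + (0, m') ∈ Submodule.span (PolyRing 𝕜 n)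
        (((ℳ 0).prod (ℳ' 0) : Submodule 𝕜 (M × M')) : Set (M × M')) :=
      Submodule.add_mem _ (e1 (Submodule.mem_top (R := PolyRing 𝕜 n) (x := m)))
      (e2 (Submodule.mem_top (R := PolyRing 𝕜 n) (x := m')))
    rwa [Prod.mk_add_mk, add_zero, zero_add] at this
  · rintro ⟨m, m'⟩
    refine Prod.ext ?_ ?_
    · show (f * f') • m = 0
      rw [mul_comm, mul_smul, hfm, smul_zero]
    · show (f * f') • m' = 0
      rw [mul_smul, hfm', smul_zero]
  · intro j
    have := hfd j
    have := hfd' j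
    exact Module.Finite.equiv (submoduleProdEquiv (ℳ j) (ℳ' j)).symm
  · funext j
    have := hfd j
    have := hfd' j
    simp only [Pi.add_apply, hilbertFun]
    rw [(submoduleProdEquiv (ℳ j) (ℳ' j)).finrank_eq, Module.finrank_prod]
    push_cast
    rfl

lemma isTorsionHilbertFunction_zero (𝕜 : Type u) [Field 𝕜] (n : ℕ) :
    IsTorsionHilbertFunction 𝕜 n 0 := by
  have := isTorsionHilbertFunction_countMon 𝕜 (n := n) (s := Set.univ) isUpperSet_univ
    Set.univ_nonempty
  convert! this using 1
  funext j
  simp [countMon]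

lemma IsTorsionHilbertFunction.nsmul {𝕜 : Type u} [Field 𝕜] {n : ℕ} {h : ℕ → ℚ}
    (hh : IsTorsionHilbertFunction 𝕜 n h) (N : ℕ) : IsTorsionHilbertFunction 𝕜 n (N • h) := by
  induction N with
  | zero => rw [zero_smul]; exact isTorsionHilbertFunction_zero 𝕜 n
  | succ N ih => rw [succ_nsmul]; exact ih.add hh

lemma isTorsionHilbertFunction_sum {𝕜 : Type u} [Field 𝕜] {n : ℕ} {ι : Type*} (s : Finset ι)
    (h : ι → ℕ → ℚ) (hh : ∀ i ∈ s, IsTorsionHilbertFunction 𝕜 n (h i)) :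
    IsTorsionHilbertFunction 𝕜 n (∑ i ∈ s, h i) :=
  Finset.sum_induction _ _ (fun _ _ => IsTorsionHilbertFunction.add)
    (isTorsionHilbertFunction_zero 𝕜 n) hh

/-- Some positive multiple of a non-negative rational combination of Hilbert functions is a Hilbert
function: clear denominators. -/
lemma exists_isTorsionHilbertFunction_nsmul {𝕜 : Type u} [Field 𝕜] {n : ℕ} {ι : Type*}
    (s : Finset ι) (c : ι → ℚ) (h : ι → ℕ → ℚ) (hc : ∀ i ∈ s, 0 ≤ c i)
    (hh : ∀ i ∈ s, IsTorsionHilbertFunction 𝕜 n (h i)) :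
    ∃ N : ℕ, 0 < N ∧ IsTorsionHilbertFunction 𝕜 n ((N : ℚ) • ∑ i ∈ s, c i • h i) := by
  classical
  refine ⟨∏ i ∈ s, (c i).den, Finset.prod_pos fun i _ => (c i).den_pos, ?_⟩
  rw [Finset.smul_sum]
  refine isTorsionHilbertFunction_sum s _ fun i hi => ?_
  have : ((∏ k ∈ s, (c k).den : ℕ) : ℚ) • c i • h i =
      ((∏ k ∈ s.erase i, (c k).den) * (c i).num.toNat) • h i := by
    rw [← Nat.cast_smul_eq_nsmul ℚ, smul_smul]
    congr 1
    have h1 : (((c i).num.toNat : ℕ) : ℚ) = (c i).num := by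
      exact_mod_cast Int.toNat_of_nonneg (Rat.num_nonneg.2 (hc i hi))
    rw [← Finset.mul_prod_erase s _ hi, Nat.cast_mul, Nat.cast_mul, h1, mul_right_comm,
      Rat.den_mul_eq_num, mul_comm]
  rw [this]
  exact (hh i hi).nsmul _

/-! ### Powers of ideals generated by variables -/

/-- The degree of a monomial in the first `c` variables. -/
def headDeg {n : ℕ} (c : ℕ) (α : Fin (n + 1) →₀ ℕ) : ℕ :=
  ∑ i ∈ Finset.univ.filter (fun i : Fin (n + 1) => (i : ℕ) < c), α i

lemma headDeg_add_single {n c : ℕ} (α : Fin (n + 1) →₀ ℕ) (i : Fin (n + 1)) :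
    headDeg c (α + Finsupp.single i 1) = headDeg c α + if (i : ℕ) < c then 1 else 0 := by
  simp [headDeg, Finset.sum_add_distrib, Finsupp.single_apply]

/-- The exponents of the monomials in `⟨x₀, …, x_{c-1}⟩^(J+1)`. -/
def headSet (n c J : ℕ) : Set (Fin (n + 1) →₀ ℕ) := {α | J < headDeg c α}

lemma isUpperSet_headSet (n c J : ℕ) : IsUpperSet (headSet n c J) := by
  intro α β h hα
  exact lt_of_lt_of_le hα (Finset.sum_le_sum fun i _ => h i)

lemma headSet_nonempty (n : ℕ) {c : ℕ} (hc : 0 < c) (J : ℕ) : (headSet n c J).Nonempty := by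
  refine ⟨Finsupp.single 0 (J + 1), ?_⟩
  have : headDeg c (Finsupp.single (0 : Fin (n + 1)) (J + 1)) = J + 1 := by
    rw [headDeg, Finset.sum_eq_single_of_mem 0 (by simp [hc]) fun i _ hi => by
      simp [hi.symm]]
    simp
  rw [headSet, Set.mem_ofPred_eq, this]
  exact Nat.lt_succ_self J

/-- The Hilbert function of `S/⟨x₀, …, x_{c-1}⟩^(J+1)`. -/
def headFun (n c J : ℕ) : ℕ → ℚ := countMon (· ∉ headSet n c J)

lemma isTorsionHilbertFunction_headFun (𝕜 : Type u) [Field 𝕜] (n : ℕ) {c : ℕ} (hc : 0 < c)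
    (J : ℕ) : IsTorsionHilbertFunction 𝕜 n (headFun n c J) :=
  isTorsionHilbertFunction_countMon 𝕜 (isUpperSet_headSet n c J) (headSet_nonempty n hc J)

lemma headDeg_le {n c : ℕ} (α : Fin (n + 1) →₀ ℕ) : headDeg c α ≤ ∑ i, α i :=
  Finset.sum_le_sum_of_subset (Finset.filter_subset _ _)

lemma headDeg_eq_degree {n : ℕ} (α : Fin (n + 1) →₀ ℕ) : headDeg (n + 1) α = ∑ i, α i := by
  rw [headDeg, Finset.filter_true_of_mem fun i _ => i.2]

lemma hilbertFunPower_succ (𝕜 : Type u) [Field 𝕜] (n J : ℕ) :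
    hilbertFunPower 𝕜 n (J + 1) = headFun n (n + 1) J := by
  have : (irrelevantIdeal 𝕜 n) ^ (J + 1) =
      MvPolynomial.restrictSupportIdeal 𝕜 _ (isUpperSet_headSet n (n + 1) J) := by
    ext f
    rw [mem_restrictSupportIdeal_iff]
    show f ∈ MvPolynomial.idealOfVars (Fin (n + 1)) 𝕜 ^ (J + 1) ↔ _
    rw [MvPolynomial.mem_pow_idealOfVars_iff]
    simp [headSet, headDeg_eq_degree, Finsupp.degree_eq_sum]
  funext j
  rw [hilbertFunPower, this, hilbertFun_quotientGrading, headFun]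

/-- The number of degree `j` monomials of degree `l` in the first `c` variables. -/
lemma card_headDeg_eq {n c : ℕ} (hc : c ≤ n + 1) {l j : ℕ} (hl : l ≤ j) :
    ((Finset.univ.finsuppAntidiag j : Finset (Fin (n + 1) →₀ ℕ)).filter
      fun α => headDeg c α = l).card =
      (c + l - 1).choose l * (n + 1 - c + (j - l) - 1).choose (j - l) := by
  classical
  set H : Finset (Fin (n + 1)) := Finset.univ.filter (fun i => (i : ℕ) < c) with hH
  have hHc : H.card = c := by
    rw [hH, Fin.card_filter_val_lt, min_eq_right hc]
  have hHc' : Hᶜ.card = n + 1 - c := by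
    rw [Finset.card_compl, hHc, Fintype.card_fin]
  have hA := Finset.card_finsuppAntidiag_nat_eq_choose (s := H) l
  have hB := Finset.card_finsuppAntidiag_nat_eq_choose (s := Hᶜ) (j - l)
  rw [hHc] at hA
  rw [hHc'] at hB
  rw [← hA, ← hB, ← Finset.card_product]
  have hz : ∀ (s : Finset (Fin (n + 1))) (β : Fin (n + 1) →₀ ℕ), β.support ⊆ s →
      ∀ i ∉ s, β i = 0 := fun s β h i hi =>
    Finsupp.notMem_support_iff.1 fun hm => hi (h hm)
  refine Finset.card_nbij' (fun α => (α.filter (· ∈ H), α.filter (· ∈ Hᶜ)))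
    (fun x => x.1 + x.2) ?_ ?_ ?_ ?_
  · intro α hα
    simp only [Finset.coe_filter, Finset.mem_finsuppAntidiag, Set.mem_ofPred_eq] at hα
    obtain ⟨⟨h1, -⟩, h2⟩ := hα
    have h2' : ∑ i ∈ H, α i = l := h2
    have h3 : ∑ i ∈ Hᶜ, α i = j - l := by
      have := Finset.sum_add_sum_compl H (fun i => α i)
      have h1' : ∑ i, α i = j := h1
      omega
    simp only [Finset.coe_product, Set.mem_prod, Finset.mem_coe, Finset.mem_finsuppAntidiag]
    refine ⟨⟨?_, ?_⟩, ?_, ?_⟩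
    · rw [← h2']
      exact Finset.sum_congr rfl fun i hi => Finsupp.filter_apply_pos _ _ hi
    · intro i hi
      by_contra hne
      exact Finsupp.mem_support_iff.1 hi (Finsupp.filter_apply_neg _ _ hne)
    · rw [← h3]
      exact Finset.sum_congr rfl fun i hi => Finsupp.filter_apply_pos _ _ hi
    · intro i hi
      by_contra hne
      exact Finsupp.mem_support_iff.1 hi (Finsupp.filter_apply_neg _ _ hne)
  · rintro ⟨β, γ⟩ h
    simp only [Finset.coe_product, Set.mem_prod, Finset.mem_coe, Finset.mem_finsuppAntidiag] at h
    obtain ⟨⟨h1, h2⟩, h3, h4⟩ := h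
    have e1 : ∑ i ∈ H, (β + γ) i = l := by
      rw [← h1]
      refine Finset.sum_congr rfl fun i hi => ?_
      rw [Finsupp.add_apply, hz _ _ h4 i (by simpa using hi), add_zero]
    have e2 : ∑ i ∈ Hᶜ, (β + γ) i = j - l := by
      rw [← h3]
      refine Finset.sum_congr rfl fun i hi => ?_
      rw [Finsupp.add_apply, hz _ _ h2 i (by simpa using hi), zero_add]
    simp only [Finset.coe_filter, Finset.mem_finsuppAntidiag, Set.mem_ofPred_eq,
      Finset.subset_univ, and_true]
    refine ⟨?_, e1⟩
    have := Finset.sum_add_sum_compl H (fun i => (β + γ) i)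
    rw [e1, e2] at this
    rw [show Finset.univ.sum ⇑(β + γ) = ∑ i, (β + γ) i from rfl, ← this]
    omega
  · intro α _
    ext i
    by_cases hi : i ∈ H <;> simp
  · rintro ⟨β, γ⟩ h
    simp only [Finset.coe_product, Set.mem_prod, Finset.mem_coe, Finset.mem_finsuppAntidiag] at h
    obtain ⟨⟨-, h2⟩, -, h4⟩ := h
    refine Prod.ext ?_ ?_
    · ext i
      by_cases hi : i ∈ H
      · simp [hi, hz _ _ h4 i (by simpa using hi)]
      · simp [hi, hz _ _ h2 i hi]
    · ext i
      by_cases hi : i ∈ H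
      · simp [hi, hz _ _ h4 i (by simpa using hi)]
      · simp [hi, hz _ _ h2 i hi]

/-- The image of the Hilbert function of `S/⟨x₀, …, x_{c-1}⟩^(J+1)` under `T` is a truncated
binomial coefficient: only monomials of degree exactly `J` in the first `c` variables can be
multiplied into the ideal by a variable. -/
lemma T_headFun {n c : ℕ} (hc : c ≤ n + 1) (J j : ℕ) :
    T n (headFun n c J) j = if J ≤ j then
      ((J : ℚ) + c) * (c + J - 1).choose J * (n + 1 - c + (j - J) - 1).choose (j - J) else 0 := by
  classical
  have h1 : T n (headFun n c J) j = ∑ α ∈ (Finset.univ.finsuppAntidiag j :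
      Finset (Fin (n + 1) →₀ ℕ)).filter (fun α => headDeg c α = J), ((J : ℚ) + c) := by
    have hdef := countMon_deficiency (n := n) (· ∉ headSet n c J) (fun α i h h' =>
      h (isUpperSet_headSet n c J (by simp) h')) j
    show ((n : ℚ) + j + 1) * countMon _ j - ((j : ℚ) + 1) * countMon _ (j + 1) = _
    rw [hdef]
    have hfil : (Finset.univ.finsuppAntidiag j : Finset (Fin (n + 1) →₀ ℕ)).filter
        (fun α => headDeg c α = J) = ((Finset.univ.finsuppAntidiag j :
          Finset (Fin (n + 1) →₀ ℕ)).filter (· ∉ headSet n c J)).filter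
            (fun α => headDeg c α = J) := by
      rw [Finset.filter_filter]
      refine Finset.filter_congr fun α _ => ?_
      simp only [headSet, Set.mem_ofPred_eq, not_lt]
      exact ⟨fun h => ⟨h.le, h⟩, fun h => h.2⟩
    rw [hfil, Finset.sum_filter (fun α => headDeg c α = J)]
    refine Finset.sum_congr (by congr!) fun α hα => ?_
    have hle : headDeg c α ≤ J := not_lt.1 (Finset.mem_filter.1 hα).2
    simp only [headSet, Set.mem_ofPred_eq, not_lt, headDeg_add_single]
    split_ifs with hJ
    · have : ∀ i : Fin (n + 1), (if headDeg c α + (if (i : ℕ) < c then 1 else 0) ≤ J then (0 : ℚ)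
          else (α i : ℚ) + 1) = if (i : ℕ) < c then (α i : ℚ) + 1 else 0 := by
        intro i
        by_cases hi : (i : ℕ) < c <;> simp [hi, hJ]
      rw [Finset.sum_congr rfl fun i _ => this i, ← Finset.sum_filter, Finset.sum_add_distrib]
      congr 1
      · rw [← hJ, headDeg]; push_cast; rfl
      · simp [Fin.card_filter_val_lt, hc]
    · refine Finset.sum_eq_zero fun i _ => if_pos ?_
      split_ifs <;> omega
  rw [h1, Finset.sum_const, nsmul_eq_mul]
  split_ifs with hJ
  · rw [card_headDeg_eq hc hJ]
    push_cast
    ring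
  · rw [Finset.filter_false_of_mem, Finset.card_empty, Nat.cast_zero, zero_mul]
    intro α hα h
    have := headDeg_le (c := c) α
    have h' : ∑ i, α i = j := (Finset.mem_finsuppAntidiag.1 hα).1
    omega

lemma headFun_apply {n c : ℕ} (hc : c ≤ n + 1) {J j : ℕ} (hJ : J ≤ j) :
    headFun n c J j = ∑ l ∈ Finset.range (J + 1),
      ((c + l - 1).choose l : ℚ) * (n + 1 - c + (j - l) - 1).choose (j - l) := by
  classical
  have : ((Finset.univ.finsuppAntidiag j : Finset (Fin (n + 1) →₀ ℕ)).filter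
      (· ∉ headSet n c J)).card = ∑ l ∈ Finset.range (J + 1),
        ((Finset.univ.finsuppAntidiag j : Finset (Fin (n + 1) →₀ ℕ)).filter
          fun α => headDeg c α = l).card := by
    rw [Finset.card_eq_sum_card_fiberwise (f := headDeg c) (t := Finset.range (J + 1))]
    · refine Finset.sum_congr rfl fun l hl => ?_
      congr 1
      rw [Finset.filter_filter]
      refine Finset.filter_congr fun α _ => ?_
      rw [Finset.mem_range] at hl
      simp only [headSet, Set.mem_ofPred_eq, not_lt]
      exact ⟨fun h => h.2, fun h => ⟨by omega, h⟩⟩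
    · intro α hα
      have hle : headDeg c α ≤ J := not_lt.1 (Finset.mem_filter.1 hα).2
      simpa using Nat.lt_succ_of_le hle
  rw [headFun, countMon]
  have h2 := congrArg (Nat.cast (R := ℚ)) this
  rw [Nat.cast_sum] at h2
  refine Eq.trans (by congr!) (h2.trans (Finset.sum_congr rfl fun l hl => ?_))
  rw [Finset.mem_range] at hl
  rw [card_headDeg_eq hc (by omega), Nat.cast_mul]

/-! ### The operator on polynomials -/

/-- The operator on polynomials that corresponds to `T`: it sends `q` to
`(n + X + 1) q(X) - (X + 1) q(X + 1)`. -/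
def tPoly (n : ℕ) : ℚ[X] →ₗ[ℚ] ℚ[X] :=
  LinearMap.mulLeft ℚ (X + C ((n : ℚ) + 1)) -
    LinearMap.mulLeft ℚ (X + 1) ∘ₗ (aeval (X + 1 : ℚ[X])).toLinearMap

lemma tPoly_apply (n : ℕ) (q : ℚ[X]) :
    tPoly n q = (X + C ((n : ℚ) + 1)) * q - (X + 1) * aeval (X + 1 : ℚ[X]) q := rfl

lemma eval_tPoly (n : ℕ) (q : ℚ[X]) (x : ℚ) :
    (tPoly n q).eval x = ((n : ℚ) + x + 1) * q.eval x - (x + 1) * q.eval (x + 1) := by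
  rw [tPoly_apply, ← comp_eq_aeval]
  simp only [eval_sub, eval_mul, eval_add, eval_X, eval_C, eval_one, eval_comp]
  ring

lemma coeff_tPoly (n : ℕ) {q : ℚ[X]} {m : ℕ} (hq : q.natDegree ≤ m) :
    (tPoly n q).coeff m = ((n : ℚ) - m) * q.coeff m := by
  have hX : ∀ k ≤ m, (tPoly n (X ^ k)).coeff m = if k = m then (n : ℚ) - m else 0 := by
    intro k hk
    rw [tPoly_apply, map_pow, aeval_X, ← pow_succ', add_mul, ← pow_succ']
    rw [coeff_sub, coeff_add, coeff_C_mul, coeff_X_add_one_pow, coeff_X_pow, coeff_X_pow]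
    rcases hk.lt_or_eq with h | rfl
    · rw [if_neg h.ne', if_neg h.ne]
      rcases Nat.lt_or_ge (k + 1) m with h' | h'
      · rw [if_neg h'.ne', Nat.choose_eq_zero_of_lt h']
        simp
      · have : m = k + 1 := by omega
        subst this
        simp
    · simp
  conv_lhs => rw [q.as_sum_range_C_mul_X_pow' (Nat.lt_succ_of_le hq)]
  simp_rw [← smul_eq_C_mul]
  rw [map_sum, finsetSum_coeff]
  simp_rw [map_smul, coeff_smul, smul_eq_mul]
  rw [Finset.sum_eq_single_of_mem m (by simp)]
  · rw [hX m le_rfl, if_pos rfl, mul_comm]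
  · intro k hk hkm
    rw [hX k (Nat.lt_succ_iff.1 (Finset.mem_range.1 hk)), if_neg hkm, mul_zero]

lemma mem_degreeLT_iff_coeff {n : ℕ} {q : ℚ[X]} :
    q ∈ degreeLT ℚ n ↔ ∀ m, n ≤ m → q.coeff m = 0 := by
  rw [mem_degreeLT, degree_lt_iff_coeff_zero]

lemma natDegree_lt_of_mem_degreeLT {n : ℕ} {q : ℚ[X]} (hq : q ∈ degreeLT ℚ n) (h0 : q ≠ 0) :
    q.natDegree < n := (natDegree_lt_iff_degree_lt h0).2 (mem_degreeLT.1 hq)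

lemma natDegree_le_of_mem_degreeLT {n m : ℕ} {q : ℚ[X]} (hq : q ∈ degreeLT ℚ n) (h : n ≤ m + 1) :
    q.natDegree ≤ m := by
  rw [natDegree_le_iff_coeff_eq_zero]
  intro k hk
  exact mem_degreeLT_iff_coeff.1 hq k (by omega)

lemma tPoly_mem_degreeLT {n : ℕ} {q : ℚ[X]} (hq : q ∈ degreeLT ℚ n) :
    tPoly n q ∈ degreeLT ℚ n := by
  rw [mem_degreeLT_iff_coeff]
  intro m hm
  rw [coeff_tPoly n (natDegree_le_of_mem_degreeLT hq (by omega)),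
    mem_degreeLT_iff_coeff.1 hq m hm, mul_zero]

/-- On polynomials of degree `d < n` the operator multiplies the leading coefficient by
`n - d`. -/
lemma tPoly_natDegree_leadingCoeff {n : ℕ} {q : ℚ[X]} (hq : q ∈ degreeLT ℚ n) (h0 : q ≠ 0) :
    tPoly n q ≠ 0 ∧ (tPoly n q).leadingCoeff = ((n : ℚ) - q.natDegree) * q.leadingCoeff := by
  have hlt := natDegree_lt_of_mem_degreeLT hq h0
  have hpos : (0 : ℚ) < (n : ℚ) - q.natDegree := by
    rw [sub_pos]; exact_mod_cast hlt
  have hc := coeff_tPoly n (le_refl q.natDegree)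
  have hne : (tPoly n q).coeff q.natDegree ≠ 0 := by
    rw [hc]
    exact mul_ne_zero hpos.ne' (leadingCoeff_ne_zero.2 h0)
  have hdeg : (tPoly n q).natDegree = q.natDegree := by
    refine le_antisymm ?_ (le_natDegree_of_ne_zero hne)
    rw [natDegree_le_iff_coeff_eq_zero]
    intro k hk
    rw [coeff_tPoly n hk.le, coeff_eq_zero_of_natDegree_lt hk, mul_zero]
  refine ⟨fun h => hne (by rw [h, coeff_zero]), ?_⟩
  rw [leadingCoeff, hdeg, hc, leadingCoeff]

lemma eq_of_eventually_eval_eq {p q : ℚ[X]} (j₀ : ℕ)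
    (h : ∀ j : ℕ, j₀ ≤ j → p.eval (j : ℚ) = q.eval (j : ℚ)) : p = q := by
  refine eq_of_infinite_eval_eq p q (Set.Infinite.mono (s := (fun j : ℕ => (j : ℚ)) '' Set.Ici j₀)
    ?_ ((Set.Ici_infinite j₀).image Nat.cast_injective.injOn))
  rintro _ ⟨j, hj, rfl⟩
  exact h j hj

/-- The sequences that eventually agree with a polynomial of degree less than `n`. -/
def eventuallyPoly (n : ℕ) : Submodule ℚ (ℕ → ℚ) where
  carrier := {h | ∃ q ∈ degreeLT ℚ n, ∃ j₀ : ℕ, ∀ j, j₀ ≤ j → q.eval (j : ℚ) = h j}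
  zero_mem' := ⟨0, zero_mem _, 0, fun j _ => by simp⟩
  add_mem' := by
    rintro h h' ⟨q, hq, j₀, e⟩ ⟨q', hq', j₁, e'⟩
    refine ⟨q + q', add_mem hq hq', max j₀ j₁, fun j hj => ?_⟩
    rw [eval_add, e j (le_of_max_le_left hj), e' j (le_of_max_le_right hj)]
    rfl
  smul_mem' := by
    rintro c h ⟨q, hq, j₀, e⟩
    refine ⟨c • q, Submodule.smul_mem _ c hq, j₀, fun j hj => ?_⟩
    rw [eval_smul, e j hj]
    rfl

/-- `T` is injective on sequences with growth of degree less than `n`. -/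
lemma eq_zero_of_T_eq_zero {n : ℕ} {h : ℕ → ℚ} (hh : h ∈ eventuallyPoly n) (hT : T n h = 0) :
    h = 0 := by
  obtain ⟨q, hq, j₀, e⟩ := hh
  have hrec : ∀ j : ℕ, ((n : ℚ) + j + 1) * h j - ((j : ℚ) + 1) * h (j + 1) = 0 := fun j =>
    congrFun hT j
  have hq0 : q = 0 := by
    by_contra hne
    refine (tPoly_natDegree_leadingCoeff hq hne).1 (eq_of_eventually_eval_eq j₀ fun j hj => ?_)
    have := e (j + 1) (by omega)
    push_cast at this
    rw [eval_tPoly, e j hj, this, hrec j, eval_zero]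
  have hlarge : ∀ k j : ℕ, j₀ ≤ j + k → h j = 0 := by
    intro k
    induction k with
    | zero => intro j hj; rw [← e j hj, hq0, eval_zero]
    | succ k ih =>
      intro j hj
      have h1 := ih (j + 1) (by omega)
      have h2 := hrec j
      rw [h1, mul_zero, sub_zero] at h2
      exact (mul_eq_zero.1 h2).resolve_left (by positivity)
  funext j
  exact hlarge j₀ j (by omega)

/-- Hilbert functions of `S/⟨x₀, …, x_{c-1}⟩^(J+1)` have growth of degree less than `n`. -/
lemma headFun_mem_eventuallyPoly {n c : ℕ} (hc0 : 0 < c) (hc : c ≤ n + 1) (J : ℕ) :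
    headFun n c J ∈ eventuallyPoly n := by
  rcases hc.lt_or_eq with h | rfl
  · refine ⟨∑ l ∈ Finset.range (J + 1), ((c + l - 1).choose l : ℚ) • preHilbertPoly ℚ (n - c) l,
      sum_mem fun l _ => Submodule.smul_mem _ _ ?_, J, fun j hj => ?_⟩
    · rw [mem_degreeLT_iff_coeff]
      intro m hm
      refine coeff_eq_zero_of_natDegree_lt ?_
      rw [natDegree_preHilbertPoly]
      omega
    · rw [headFun_apply hc hj, eval_finsetSum]
      refine Finset.sum_congr rfl fun l hl => ?_
      rw [Finset.mem_range] at hl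
      rw [eval_smul, smul_eq_mul, preHilbertPoly_eq_choose_sub_add ℚ _ (by omega)]
      congr 2
      rw [← Nat.choose_symm_add, show n + 1 - c + (j - l) - 1 = j - l + (n - c) by omega]
  · refine ⟨0, zero_mem _, J + 1, fun j hj => ?_⟩
    rw [headFun_apply hc (by omega), eval_zero, Finset.sum_eq_zero]
    intro l hl
    rw [Finset.mem_range] at hl
    rw [Nat.choose_eq_zero_of_lt (show n + 1 - (n + 1) + (j - l) - 1 < j - l by omega),
      Nat.cast_zero, mul_zero]

/-! ### The space `V_{n,a}` -/

/-- The extension of a sequence to the integers by zero. -/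
def extZ (h : ℕ → ℚ) (j : ℤ) : ℚ := if 0 ≤ j then h j.toNat else 0

@[simp] lemma extZ_natCast (h : ℕ → ℚ) (j : ℕ) : extZ h j = h j := by simp [extZ]

lemma extZ_of_neg (h : ℕ → ℚ) {j : ℤ} (hj : j < 0) : extZ h j = 0 := by
  rw [extZ, if_neg (by omega)]

lemma extZ_coeff_mul_one_sub_X (φ : PowerSeries ℚ) (j : ℤ) :
    extZ (fun i => PowerSeries.coeff i (φ * (1 - PowerSeries.X))) (j + 1) =
      extZ (fun i => PowerSeries.coeff i φ) (j + 1) - extZ (fun i => PowerSeries.coeff i φ) j := by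
  rcases lt_trichotomy j (-1) with h | rfl | h
  · rw [extZ_of_neg _ (by omega), extZ_of_neg _ (by omega), extZ_of_neg _ (by omega), sub_zero]
  · simp [extZ, mul_sub]
  · obtain ⟨k, rfl⟩ := Int.eq_ofNat_of_zero_le (show 0 ≤ j by omega)
    have : (k : ℤ) + 1 = ((k + 1 : ℕ) : ℤ) := by push_cast; rfl
    rw [this, extZ_natCast, extZ_natCast, extZ_natCast, mul_sub, mul_one, map_sub,
      PowerSeries.coeff_succ_mul_X]

/-- Multiplication of a power series by `(1 - X)ⁿ` takes iterated differences of its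
coefficients. -/
lemma extZ_coeff_mul_pow (h : ℕ → ℚ) (n : ℕ) (j : ℤ) :
    extZ (fun i => PowerSeries.coeff i (PowerSeries.mk h * (1 - PowerSeries.X) ^ n)) (j + n) =
      (fwdDiff 1)^[n] (extZ h) j := by
  induction n generalizing j with
  | zero => simp
  | succ n ih =>
    rw [Function.iterate_succ_apply', fwdDiff, ← ih, ← ih, pow_succ, ← mul_assoc]
    push_cast
    rw [← add_assoc, extZ_coeff_mul_one_sub_X, add_right_comm]

lemma mem_V_iff_fwdDiff {n : ℕ} {a : ℤ} (ha : -(n : ℤ) ≤ a) (h : ℕ → ℚ) :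
    h ∈ V n a ↔ ∀ j : ℤ, a < j → (fwdDiff 1)^[n] (extZ h) j = 0 := by
  constructor
  · rintro ⟨B, hB, e⟩ j hj
    rw [← extZ_coeff_mul_pow, e]
    rw [extZ, if_pos (by omega), Polynomial.coeff_coe]
    exact mem_degreeLT_iff_coeff.1 hB _ (by omega)
  · intro hd
    refine ⟨PowerSeries.trunc (a + n + 1).toNat (PowerSeries.mk h * (1 - PowerSeries.X) ^ n),
      ?_, ?_⟩
    · rw [mem_degreeLT_iff_coeff]
      intro m hm
      rw [PowerSeries.coeff_trunc, if_neg (by omega)]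
    · ext m
      rw [Polynomial.coeff_coe, PowerSeries.coeff_trunc]
      split_ifs with hm
      · rfl
      · have := hd (m - n) (by omega)
        rw [← extZ_coeff_mul_pow, sub_add_cancel, extZ_natCast] at this
        exact this

lemma fwdDiff_iter_eq_zero {G : ℤ → ℚ} {a : ℤ} (hG : ∀ j, a < j → G j = 0) (m : ℕ) {j : ℤ}
    (hj : a < j) : (fwdDiff 1)^[m] G j = 0 := by
  rw [fwdDiff_iter_eq_sum_shift]
  refine Finset.sum_eq_zero fun k _ => ?_
  rw [hG _ (by simp; omega), smul_zero]

/-- The elements of `V_{n,a}` are the sequences which, extended by zero to the negative integers,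
agree with a polynomial of degree less than `n` on all integers greater than `a`. -/
lemma mem_V_iff {n : ℕ} {a : ℤ} (ha : -(n : ℤ) ≤ a) (h : ℕ → ℚ) :
    h ∈ V n a ↔ ∃ q ∈ degreeLT ℚ n, ∀ j : ℤ, a < j → q.eval (j : ℚ) = extZ h j := by
  rw [mem_V_iff_fwdDiff ha]
  constructor
  · intro hd
    refine ⟨∑ k ∈ Finset.range n, ((fwdDiff 1)^[k] (extZ h) (a + 1) * (k.factorial : ℚ)⁻¹) •
      (descPochhammer ℚ k).comp (X - C ((a : ℚ) + 1)), sum_mem fun k hk =>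
        Submodule.smul_mem _ _ ?_, fun j hj => ?_⟩
    · rw [mem_degreeLT_iff_coeff]
      intro m hm
      refine coeff_eq_zero_of_natDegree_lt ?_
      rw [natDegree_comp, natDegree_X_sub_C, mul_one, descPochhammer_natDegree]
      exact lt_of_lt_of_le (Finset.mem_range.1 hk) hm
    · obtain ⟨m, hm⟩ := Int.eq_ofNat_of_zero_le (show 0 ≤ j - (a + 1) by omega)
      obtain rfl : j = a + 1 + m := by omega
      have hsh := shift_eq_sum_fwdDiff_iter 1 (extZ h) m (a + 1)
      rw [nsmul_eq_mul, mul_one] at hsh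
      have hz : ∀ k, n ≤ k → (fwdDiff 1)^[k] (extZ h) (a + 1) = 0 := by
        intro k hk
        obtain ⟨i, rfl⟩ := Nat.exists_eq_add_of_le' hk
        rw [Function.iterate_add_apply]
        exact fwdDiff_iter_eq_zero hd i (by omega)
      have hterm : ∀ k, (((fwdDiff 1)^[k] (extZ h) (a + 1) * (k.factorial : ℚ)⁻¹) •
          (descPochhammer ℚ k).comp (X - C ((a : ℚ) + 1))).eval ((a + 1 + m : ℤ) : ℚ) =
          m.choose k • (fwdDiff 1)^[k] (extZ h) (a + 1) := by
        intro k
        have hk : (k.factorial : ℚ) ≠ 0 := by positivity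
        have : ((a + 1 + m : ℤ) : ℚ) - (a + 1) = (m : ℚ) := by push_cast; ring
        rw [eval_smul, eval_comp, eval_sub, eval_X, eval_C, this,
          descPochhammer_eval_eq_descFactorial, Nat.descFactorial_eq_factorial_mul_choose,
          nsmul_eq_mul, smul_eq_mul]
        push_cast
        field_simp
      rw [hsh, eval_finsetSum, Finset.sum_congr rfl fun k _ => hterm k]
      -- both sums agree with the one over the common range, as `m.choose k = 0` for `k > m`
      have h1 : ∑ k ∈ Finset.range n, m.choose k • (fwdDiff 1)^[k] (extZ h) (a + 1) =
          ∑ k ∈ Finset.range (max n (m + 1)), m.choose k • (fwdDiff 1)^[k] (extZ h) (a + 1) := by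
        refine Finset.sum_subset (Finset.range_mono (le_max_left _ _)) fun k _ hk => ?_
        rw [hz k (by simpa using hk), smul_zero]
      have h2 : ∑ k ∈ Finset.range (m + 1), m.choose k • (fwdDiff 1)^[k] (extZ h) (a + 1) =
          ∑ k ∈ Finset.range (max n (m + 1)), m.choose k • (fwdDiff 1)^[k] (extZ h) (a + 1) := by
        refine Finset.sum_subset (Finset.range_mono (le_max_right _ _)) fun k _ hk => ?_
        rw [Nat.choose_eq_zero_of_lt (by simpa using hk), zero_smul]
      rw [h1, h2]
  · rintro ⟨q, hq, e⟩ j hj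
    have h0 : (fwdDiff 1)^[n] q.eval (j : ℚ) = 0 := by
      by_cases hq0 : q = 0
      · subst hq0
        rw [fwdDiff_iter_eq_sum_shift]
        simp
      · rw [fwdDiff_iter_eq_zero_of_degree_lt (natDegree_lt_of_mem_degreeLT hq hq0)]
        rfl
    rw [← h0, fwdDiff_iter_eq_sum_shift, fwdDiff_iter_eq_sum_shift]
    refine Finset.sum_congr rfl fun k _ => ?_
    rw [← e _ (by simp; omega)]
    simp

lemma V_le_eventuallyPoly {n : ℕ} {a : ℤ} (ha : -(n : ℤ) ≤ a) : V n a ≤ eventuallyPoly n := by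
  intro h hh
  obtain ⟨q, hq, e⟩ := (mem_V_iff ha h).1 hh
  exact ⟨q, hq, (a + 1).toNat, fun j hj => by
    have := e j (by omega)
    simpa using this⟩

lemma T_mem_V {n : ℕ} {a : ℤ} (ha : -(n : ℤ) ≤ a) {h : ℕ → ℚ} (hh : h ∈ V n a) :
    T n h ∈ V n a := by
  obtain ⟨q, hq, e⟩ := (mem_V_iff ha h).1 hh
  refine (mem_V_iff ha _).2 ⟨tPoly n q, tPoly_mem_degreeLT hq, fun j hj => ?_⟩
  have e1 := e j hj
  have e2 := e (j + 1) (by omega)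
  push_cast at e2
  rw [eval_tPoly, e1, e2]
  rcases lt_trichotomy j (-1) with h1 | rfl | h1
  · rw [extZ_of_neg _ (by omega), extZ_of_neg _ (by omega), extZ_of_neg _ (by omega)]
    ring
  · rw [extZ_of_neg h (show (-1 : ℤ) < 0 by omega),
      extZ_of_neg (T n h) (show (-1 : ℤ) < 0 by omega)]
    push_cast
    ring
  · obtain ⟨k, rfl⟩ := Int.eq_ofNat_of_zero_le (show 0 ≤ j by omega)
    have : (k : ℤ) + 1 = ((k + 1 : ℕ) : ℤ) := by push_cast; rfl
    rw [this, extZ_natCast, extZ_natCast, extZ_natCast]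
    rfl

lemma finite_V (n : ℕ) (a : ℤ) : Module.Finite ℚ (V n a) := by
  let N := (a + n + 1).toNat
  let f : V n a →ₗ[ℚ] (Fin N → ℚ) :=
    LinearMap.funLeft ℚ ℚ (fun i : Fin N => (i : ℕ)) ∘ₗ (V n a).subtype
  refine Module.Finite.of_injective f ((injective_iff_map_eq_zero f).2 ?_)
  rintro ⟨h, B, hB, e⟩ h0
  have hlow : ∀ i < N, h i = 0 := fun i hi => congrFun h0 ⟨i, hi⟩
  have hB0 : B = 0 := by
    ext m
    rw [coeff_zero]
    by_cases hm : m < N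
    · rw [← Polynomial.coeff_coe, ← e, PowerSeries.coeff_mul]
      refine Finset.sum_eq_zero fun x hx => ?_
      rw [PowerSeries.coeff_mk, hlow x.1 (by
        have := Finset.HasAntidiagonal.mem_antidiagonal.1 hx; omega), zero_mul]
    · exact mem_degreeLT_iff_coeff.1 hB m (not_lt.1 hm)
  have hne : (1 - PowerSeries.X : PowerSeries ℚ) ^ n ≠ 0 := by
    refine pow_ne_zero n fun h => ?_
    have := congrArg PowerSeries.constantCoeff h
    simp at this
  rw [hB0, Polynomial.coe_zero] at e
  have hmk := (mul_eq_zero.1 e).resolve_right hne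
  refine Subtype.ext (funext fun j => ?_)
  simpa using congrArg (PowerSeries.coeff j) hmk

/-- `T` restricts to a bijection of `V_{n,a}`. -/
lemma existsUnique_T_eq {n : ℕ} {a : ℤ} (ha : -(n : ℤ) ≤ a) {F : ℕ → ℚ} (hF : F ∈ V n a) :
    ∃! g : V n a, T n (g : ℕ → ℚ) = F := by
  have := finite_V n a
  let t : V n a →ₗ[ℚ] V n a := (T n).restrict fun _ hh => T_mem_V ha hh
  have hinj : Function.Injective t := by
    refine (injective_iff_map_eq_zero t).2 fun h h0 => Subtype.ext ?_
    exact eq_zero_of_T_eq_zero (V_le_eventuallyPoly ha h.2) (congrArg Subtype.val h0)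
  obtain ⟨g, hg⟩ := LinearMap.injective_iff_surjective.1 hinj ⟨F, hF⟩
  refine ⟨g, congrArg Subtype.val hg, fun g' hg' => hinj ?_⟩
  rw [hg]
  exact Subtype.ext hg'

lemma T_injective_V {n : ℕ} {a : ℤ} (ha : -(n : ℤ) ≤ a) {g g' : V n a}
    (h : T n (g : ℕ → ℚ) = T n (g' : ℕ → ℚ)) : g = g' :=
  (existsUnique_T_eq ha (T_mem_V ha g'.2)).unique h rfl

/-! ### Polynomials that are non-negative at large integers -/

lemma exists_eval_pos_of_leadingCoeff_pos {P : ℚ[X]} (h : 0 < P.leadingCoeff) :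
    ∃ j₀ : ℕ, ∀ j : ℕ, j₀ ≤ j → 0 < P.eval (j : ℚ) := by
  rcases Nat.eq_zero_or_pos P.natDegree with h0 | h0
  · rw [eq_C_of_natDegree_eq_zero h0] at h ⊢
    rw [leadingCoeff_C] at h
    exact ⟨0, fun j _ => by rwa [eval_C]⟩
  · have ht := (P.tendsto_atTop_of_leadingCoeff_nonneg (natDegree_pos_iff_degree_pos.1 h0)
      h.le).comp tendsto_natCast_atTop_atTop
    exact Filter.eventually_atTop.1 (ht.eventually_gt_atTop 0)

lemma leadingCoeff_pos_of_eval_nonneg {P : ℚ[X]} (h0 : P ≠ 0) (j₀ : ℕ)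
    (h : ∀ j : ℕ, j₀ ≤ j → 0 ≤ P.eval (j : ℚ)) : 0 < P.leadingCoeff := by
  by_contra hneg
  have hlt : P.leadingCoeff < 0 := lt_of_le_of_ne (not_lt.1 hneg) (leadingCoeff_ne_zero.2 h0)
  obtain ⟨j₁, h₁⟩ := exists_eval_pos_of_leadingCoeff_pos (P := -P) (by
    rw [leadingCoeff_neg]; linarith)
  have e1 := h (max j₀ j₁) (le_max_left _ _)
  have e2 := h₁ (max j₀ j₁) (le_max_right _ _)
  rw [eval_neg] at e2
  linarith

/-- If `P ≥ Q ≥ 0` at large integers then `deg Q ≤ deg P`. -/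
lemma natDegree_le_of_eval_le {P Q : ℚ[X]} (hQ : Q ≠ 0) (j₀ : ℕ)
    (h0 : ∀ j : ℕ, j₀ ≤ j → 0 ≤ Q.eval (j : ℚ))
    (h : ∀ j : ℕ, j₀ ≤ j → Q.eval (j : ℚ) ≤ P.eval (j : ℚ)) : Q.natDegree ≤ P.natDegree := by
  by_contra hlt
  rw [not_le] at hlt
  have hpos := leadingCoeff_pos_of_eval_nonneg hQ j₀ h0
  have hlc : (P - Q).leadingCoeff = -Q.leadingCoeff :=
    leadingCoeff_sub_of_degree_lt' (degree_lt_degree hlt)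
  have hne : P - Q ≠ 0 := by
    rw [← leadingCoeff_ne_zero, hlc]
    exact neg_ne_zero.2 hpos.ne'
  have := leadingCoeff_pos_of_eval_nonneg hne j₀ fun j hj => by
    rw [eval_sub]; linarith [h j hj]
  rw [hlc] at this
  linarith

lemma coeff_sub_comp_X_sub_one {P : ℚ[X]} {d : ℕ} (hP : P.natDegree ≤ d + 1) :
    (P - P.comp (X - 1)).coeff d = (d + 1) * P.coeff (d + 1) ∧
      (P - P.comp (X - 1)).natDegree ≤ d := by
  have hX : ∀ k m, (X ^ k - (X - 1) ^ k : ℚ[X]).coeff m =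
      (if m = k then 1 else 0) - (-1) ^ (k - m) * k.choose m := by
    intro k m
    have h1 : (X - 1 : ℚ[X]) = X + C (-1) := by rw [C_neg, C_1, sub_eq_add_neg]
    rw [coeff_sub, h1, coeff_X_add_C_pow, coeff_X_pow]
  have hsum : ∀ m, (P - P.comp (X - 1)).coeff m =
      ∑ k ∈ Finset.range (d + 2), P.coeff k * (X ^ k - (X - 1) ^ k : ℚ[X]).coeff m := by
    intro m
    conv_lhs => rw [P.as_sum_range_C_mul_X_pow' (show P.natDegree < d + 2 by omega)]
    rw [comp_eq_aeval, map_sum, ← Finset.sum_sub_distrib, finsetSum_coeff]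
    refine Finset.sum_congr rfl fun k _ => ?_
    rw [map_mul, map_pow, aeval_X, aeval_C, algebraMap_eq, ← mul_sub]
    exact coeff_C_mul _
  constructor
  · rw [hsum, Finset.sum_range_succ, Finset.sum_range_succ, Finset.sum_eq_zero, hX, hX]
    · simp
      ring
    · intro k hk
      rw [Finset.mem_range] at hk
      rw [hX, if_neg hk.ne', Nat.choose_eq_zero_of_lt hk]
      simp
  · rw [natDegree_le_iff_coeff_eq_zero]
    intro m hm
    rw [hsum, Finset.sum_eq_zero]
    intro k hk
    rw [Finset.mem_range] at hk
    rcases (show k ≤ m by omega).lt_or_eq with h | rfl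
    · rw [hX, if_neg h.ne', Nat.choose_eq_zero_of_lt h]
      simp
    · rw [hX]
      simp

/-- Far out, a polynomial with positive leading coefficient is a non-negative combination of the
shifted binomial coefficients `C(j - J + i, i)`: the coefficients are iterated backward differences
at `J - 1`. -/
lemma exists_binomial_expansion (n : ℕ) (P : ℚ[X]) (hP : P ∈ degreeLT ℚ n)
    (hpos : P = 0 ∨ 0 < P.leadingCoeff) :
    ∃ J₀ : ℕ, ∀ J, J₀ ≤ J → ∃ c : ℕ → ℚ, (∀ i, 0 ≤ c i) ∧ ∀ j, J ≤ j →
      P.eval (j : ℚ) = ∑ i ∈ Finset.range n, c i * ((j - J + i).choose i : ℚ) := by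
  induction n generalizing P with
  | zero =>
    have : P = 0 := by
      ext m; rw [coeff_zero]; exact mem_degreeLT_iff_coeff.1 hP m (Nat.zero_le m)
    exact ⟨0, fun J _ => ⟨0, fun i => le_rfl, fun j _ => by simp [this]⟩⟩
  | succ n ih =>
    by_cases h0 : P = 0
    · exact ⟨0, fun J _ => ⟨0, fun i => le_rfl, fun j _ => by simp [h0]⟩⟩
    have hlc := hpos.resolve_left h0
    have hdeg : P.natDegree ≤ n := natDegree_le_of_mem_degreeLT hP le_rfl
    -- the backward difference again vanishes or has positive leading coefficient
    have hdiff : (P - P.comp (X - 1)) ∈ degreeLT ℚ n ∧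
        (P - P.comp (X - 1) = 0 ∨ 0 < (P - P.comp (X - 1)).leadingCoeff) := by
      rcases hd : P.natDegree with _ | d
      · have : P - P.comp (X - 1) = 0 := by
          rw [eq_C_of_natDegree_eq_zero hd, C_comp, sub_self]
        rw [this]
        exact ⟨zero_mem _, Or.inl rfl⟩
      · obtain ⟨hc, hle⟩ := coeff_sub_comp_X_sub_one hd.le
        have hcpos : 0 < (P - P.comp (X - 1)).coeff d := by
          rw [hc, ← hd]
          exact mul_pos (by positivity) hlc
        have hnd := le_antisymm hle (le_natDegree_of_ne_zero hcpos.ne')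
        refine ⟨mem_degreeLT_iff_coeff.2 fun m hm =>
          coeff_eq_zero_of_natDegree_lt (by omega), Or.inr ?_⟩
        rw [leadingCoeff, hnd]
        exact hcpos
    obtain ⟨J₀, hJ₀⟩ := ih _ hdiff.1 hdiff.2
    obtain ⟨J₁, hJ₁⟩ := exists_eval_pos_of_leadingCoeff_pos hlc
    refine ⟨max J₀ J₁ + 1, fun J hJ => ?_⟩
    obtain ⟨K, rfl⟩ : ∃ K, J = K + 1 := ⟨J - 1, by omega⟩
    obtain ⟨c, hc, hce⟩ := hJ₀ (K + 1) (by omega)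
    refine ⟨fun i => Nat.casesOn i (P.eval (K : ℚ)) c, ?_, ?_⟩
    · rintro (_ | i)
      · exact (hJ₁ K (by omega)).le
      · exact hc i
    · have hstep : ∀ t : ℕ, P.eval ((K + 1 + t : ℕ) : ℚ) =
          P.eval (K : ℚ) + ∑ i ∈ Finset.range n, c i * ((t + i + 1).choose (i + 1) : ℚ) := by
        intro t
        have hd : ∀ s : ℕ, P.eval ((K + 1 + s : ℕ) : ℚ) = P.eval ((K + s : ℕ) : ℚ) +
            ∑ i ∈ Finset.range n, c i * ((s + i).choose i : ℚ) := by
          intro s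
          have := hce (K + 1 + s) (by omega)
          rw [eval_sub, eval_comp, eval_sub, eval_X, eval_one,
            show ((K + 1 + s : ℕ) : ℚ) - 1 = ((K + s : ℕ) : ℚ) by push_cast; ring,
            show K + 1 + s - (K + 1) = s by omega] at this
          linarith
        induction t with
        | zero =>
          rw [hd 0]
          simp
        | succ t iht =>
          rw [hd (t + 1), show K + (t + 1) = K + 1 + t by omega, iht, add_assoc,
            ← Finset.sum_add_distrib]
          congr 1
          refine Finset.sum_congr rfl fun i _ => ?_
          rw [show t + 1 + i + 1 = (t + i + 1) + 1 by omega, Nat.choose_succ_succ (t + i + 1) i,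
            show t + 1 + i = t + i + 1 by omega]
          push_cast
          ring
      intro j hj
      obtain ⟨t, rfl⟩ := Nat.exists_eq_add_of_le hj
      rw [hstep t, Finset.sum_range_succ']
      simp only [Nat.add_sub_cancel_left]
      simp [add_comm, add_assoc]

/-! ### The polynomials attached to partitions -/

lemma eval_p {r : ℕ} (lam : Fin r → ℕ) (x : ℤ) :
    (p lam).eval x = ∏ i : Fin r, ((x - ((lam i.rev : ℤ) + 2 * (i : ℤ))) *
      (x - ((lam i.rev : ℤ) + 2 * (i : ℤ) + 1))) := by
  simp only [p, eval_prod, eval_mul, eval_sub, eval_X, eval_C]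

/-- Each factor of `p_λ` is a product of two consecutive integers. -/
lemma eval_p_nonneg {r : ℕ} (lam : Fin r → ℕ) (x : ℤ) : 0 ≤ (p lam).eval x := by
  rw [eval_p]
  refine Finset.prod_nonneg fun i _ => ?_
  rcases le_or_gt x ((lam i.rev : ℤ) + 2 * (i : ℤ)) with h | h
  · exact mul_nonneg_of_nonpos_of_nonpos (by omega) (by omega)
  · exact mul_nonneg (by omega) (by omega)

lemma antitone_snoc_add {r : ℕ} {lam : Fin r → ℕ} (h : Antitone lam) (t : ℕ) :
    Antitone (Fin.snoc (fun i => lam i + t) t : Fin (r + 1) → ℕ) := by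
  intro i k
  refine Fin.lastCases ?_ (fun i' => ?_) i <;> refine Fin.lastCases ?_ (fun k' => ?_) k
  · intro _; exact le_rfl
  · intro hik
    exact absurd hik (not_le.2 (Fin.castSucc_lt_last k'))
  · intro _
    rw [Fin.snoc_last, Fin.snoc_castSucc]
    exact Nat.le_add_left _ _
  · intro hik
    rw [Fin.snoc_castSucc, Fin.snoc_castSucc]
    exact Nat.add_le_add_right (h (Fin.castSucc_le_castSucc_iff.1 hik)) t

/-- Adding a smallest part `t` to a partition and `t` to all other parts puts the pair of zeros
`t, t + 1` before the zeros, shifted by `t + 2`. -/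
lemma eval_p_snoc {r : ℕ} (lam : Fin r → ℕ) (t : ℕ) (x : ℤ) :
    (p (Fin.snoc (fun i => lam i + t) t : Fin (r + 1) → ℕ)).eval x =
      (x - t) * (x - t - 1) * (p lam).eval (x - t - 2) := by
  rw [eval_p, eval_p, Fin.prod_univ_succ]
  congr 1
  · rw [Fin.rev_zero, Fin.snoc_last, Fin.val_zero, Nat.cast_zero, mul_zero, add_zero, sub_sub]
  · refine Finset.prod_congr rfl fun i _ => ?_
    rw [Fin.rev_succ, Fin.snoc_castSucc]
    push_cast [Fin.val_succ]
    ring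

lemma eval_p_add_one {r : ℕ} (lam : Fin r → ℕ) (x : ℤ) :
    (p (fun i => lam i + 1)).eval x = (p lam).eval (x - 1) := by
  rw [eval_p, eval_p]
  refine Finset.prod_congr rfl fun i _ => ?_
  push_cast
  ring

/-- A real polynomial that is non-negative at the integers `≥ m` and positive somewhere to the left
of `m` has at least as many roots as the smallest union of pairs of consecutive integers that
contains its integral zeros `≥ m`. If `k` is the least such zero, there is a second root `ξ` that is
at most `k + 1`, and the quotient by `(s - k) (s - ξ)` is non-negative at the integers `≥ k + 2`. -/
lemma exists_partition_of_eval_pos (d : ℕ) : ∀ (P : ℝ[X]) (m : ℤ) (y : ℝ), P.natDegree ≤ d →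
    y < m → 0 < P.eval y → (∀ j : ℤ, m ≤ j → 0 ≤ P.eval (j : ℝ)) →
    ∃ (r : ℕ) (lam : Fin r → ℕ), Antitone lam ∧ 2 * r ≤ P.natDegree ∧
      ∀ j : ℤ, m ≤ j → P.eval (j : ℝ) = 0 → (p lam).eval (j - m) = 0 := by
  induction d using Nat.strong_induction_on with
  | _ d ih =>
  intro P m y hd hy hPy hP
  have hP0 : P ≠ 0 := by rintro rfl; simp at hPy
  by_cases hz : ∃ j : ℤ, m ≤ j ∧ P.eval (j : ℝ) = 0
  swap
  · exact ⟨0, Fin.elim0, fun i => i.elim0, by omega, fun j hj h => absurd ⟨j, hj, h⟩ hz⟩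
  obtain ⟨k, ⟨hmk, hk⟩, hmin⟩ := Int.exists_least_of_bdd
    (P := fun j : ℤ => m ≤ j ∧ P.eval (j : ℝ) = 0) ⟨m, fun z hz => hz.1⟩ hz
  obtain ⟨P₁, rfl⟩ := dvd_iff_isRoot.2 (show P.IsRoot (k : ℝ) from hk)
  have hmk' : (m : ℝ) ≤ k := by exact_mod_cast hmk
  have hneg : P₁.eval y < 0 := by
    rw [eval_mul, eval_sub, eval_X, eval_C] at hPy
    by_contra hcon
    have := mul_nonpos_of_nonpos_of_nonneg (show y - k ≤ 0 by linarith) (not_lt.1 hcon)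
    linarith
  have hnext : 0 ≤ P₁.eval ((k : ℝ) + 1) := by
    have := hP (k + 1) (by omega)
    rw [eval_mul, eval_sub, eval_X, eval_C] at this
    push_cast at this
    simpa using this
  obtain ⟨ξ, ⟨hξ1, hξ2⟩, hξ⟩ := intermediate_value_Icc (show y ≤ (k : ℝ) + 1 by linarith)
    P₁.continuous.continuousOn ⟨hneg.le, hnext⟩
  have hξy : y < ξ := lt_of_le_of_ne hξ1 (by
    rintro rfl
    exact absurd hξ hneg.ne)
  obtain ⟨P₂, rfl⟩ := dvd_iff_isRoot.2 (show P₁.IsRoot ξ from hξ)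
  have hP₂0 : P₂ ≠ 0 := by rintro rfl; simp at hP0
  have hdeg : ((X - C (k : ℝ)) * ((X - C ξ) * P₂)).natDegree = P₂.natDegree + 2 := by
    rw [natDegree_mul (X_sub_C_ne_zero _) (mul_ne_zero (X_sub_C_ne_zero _) hP₂0),
      natDegree_mul (X_sub_C_ne_zero _) hP₂0, natDegree_X_sub_C, natDegree_X_sub_C]
    ring
  have hev : ∀ x : ℝ, ((X - C (k : ℝ)) * ((X - C ξ) * P₂)).eval x =
      (x - k) * (x - ξ) * P₂.eval x := by
    intro x
    simp only [eval_mul, eval_sub, eval_X, eval_C, mul_assoc]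
  have hfac : ∀ j : ℤ, k + 2 ≤ j → 0 < ((j : ℝ) - k) * (j - ξ) := by
    intro j hj
    have : (k : ℝ) + 2 ≤ j := by exact_mod_cast hj
    exact mul_pos (by linarith) (by linarith)
  rw [hdeg] at hd
  obtain ⟨r, lam, hlam, hr, hzero⟩ := ih P₂.natDegree (by omega) P₂ (k + 2) y le_rfl
    (by push_cast; linarith) (by
      rw [hev] at hPy
      exact pos_of_mul_pos_right hPy (mul_nonneg_of_nonpos_of_nonpos (by linarith)
        (by linarith)))
    (by
      intro j hj
      have := hP j (by omega)
      rw [hev] at this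
      exact nonneg_of_mul_nonneg_right this (hfac j hj))
  refine ⟨r + 1, Fin.snoc (fun i => lam i + (k - m).toNat) (k - m).toNat,
    antitone_snoc_add hlam _, by omega, fun j hj hj0 => ?_⟩
  have ht : (((k - m).toNat : ℕ) : ℤ) = k - m := by omega
  rw [eval_p_snoc, ht]
  have hkj := hmin j ⟨hj, hj0⟩
  rcases (show j = k ∨ j = k + 1 ∨ k + 2 ≤ j by omega) with h | h | h
  · rw [h]; ring
  · rw [h]; ring
  · rw [show j - m - (k - m) - 2 = j - (k + 2) by ring, hzero j h ?_, mul_zero]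
    rw [hev] at hj0
    exact (mul_eq_zero.1 hj0).resolve_left (hfac j h).ne'

/-- A nonzero real polynomial that is non-negative at the integers `≥ m` has degree at least that of
some explicit polynomial that vanishes at its integral zeros `≥ m`. -/
lemma exists_partition_of_eval_nonneg (d : ℕ) : ∀ (P : ℝ[X]) (m : ℤ), P.natDegree ≤ d → P ≠ 0 →
    (∀ j : ℤ, m ≤ j → 0 ≤ P.eval (j : ℝ)) →
    (∃ (r : ℕ) (lam : Fin r → ℕ), Antitone lam ∧ 2 * r ≤ P.natDegree ∧
      ∀ j : ℤ, m ≤ j → P.eval (j : ℝ) = 0 → (p lam).eval (j - m) = 0) ∨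
    (∃ (r : ℕ) (mu : Fin r → ℕ), Antitone mu ∧ 2 * r + 1 ≤ P.natDegree ∧
      ∀ j : ℤ, m ≤ j → P.eval (j : ℝ) = 0 → (j - m) * (p mu).eval (j - m - 1) = 0) := by
  induction d using Nat.strong_induction_on with
  | _ d ih =>
  intro P m hd hP0 hP
  rcases (hP m le_rfl).lt_or_eq with hpos | h0
  · left
    obtain ⟨r, lam, hlam, hr, hzero⟩ := exists_partition_of_eval_pos d P (m + 1) m hd
      (by push_cast; linarith) hpos (fun j hj => hP j (by omega))
    refine ⟨r, fun i => lam i + 1, fun i k hik => Nat.add_le_add_right (hlam hik) 1, hr,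
      fun j hj hj0 => ?_⟩
    have hne : j ≠ m := by rintro rfl; exact hpos.ne' hj0
    rw [eval_p_add_one, sub_sub]
    exact hzero j (by omega) hj0
  · obtain ⟨P₁, rfl⟩ := dvd_iff_isRoot.2 (show P.IsRoot (m : ℝ) from h0.symm)
    have hP₁0 : P₁ ≠ 0 := by rintro rfl; simp at hP0
    have hdeg : ((X - C (m : ℝ)) * P₁).natDegree = P₁.natDegree + 1 := by
      rw [natDegree_mul (X_sub_C_ne_zero _) hP₁0, natDegree_X_sub_C, add_comm]
    have hev : ∀ x : ℝ, ((X - C (m : ℝ)) * P₁).eval x = (x - m) * P₁.eval x := by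
      intro x
      simp only [eval_mul, eval_sub, eval_X, eval_C]
    have hfac : ∀ j : ℤ, m + 1 ≤ j → 0 < (j : ℝ) - m := by
      intro j hj
      have : (m : ℝ) + 1 ≤ j := by exact_mod_cast hj
      linarith
    have hz₁ : ∀ j : ℤ, m + 1 ≤ j → ((X - C (m : ℝ)) * P₁).eval (j : ℝ) = 0 →
        P₁.eval (j : ℝ) = 0 := by
      intro j hj hj0
      rw [hev] at hj0
      exact (mul_eq_zero.1 hj0).resolve_left (hfac j hj).ne'
    rw [hdeg] at hd
    rcases ih P₁.natDegree (by omega) P₁ (m + 1) le_rfl hP₁0 (fun j hj => by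
      have := hP j (by omega)
      rw [hev] at this
      exact nonneg_of_mul_nonneg_right this (hfac j hj)) with
      ⟨r, lam, hlam, hr, hzero⟩ | ⟨r, mu, hmu, hr, hzero⟩
    · right
      refine ⟨r, lam, hlam, by omega, fun j hj hj0 => ?_⟩
      rcases hj.eq_or_lt with rfl | hlt
      · rw [sub_self, zero_mul]
      · rw [sub_sub, hzero j hlt (hz₁ j hlt hj0), mul_zero]
    · left
      refine ⟨r + 1, Fin.snoc (fun i => mu i + 0) 0, antitone_snoc_add hmu 0, by omega,
        fun j hj hj0 => ?_⟩
      rw [eval_p_snoc]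
      rcases hj.eq_or_lt with rfl | hlt
      · simp
      · have := hzero j hlt (hz₁ j hlt hj0)
        rw [← sub_sub] at this
        rw [Nat.cast_zero, sub_zero, mul_assoc, show j - m - 2 = j - m - 1 - 1 by ring, this,
          mul_zero]

/-- The polynomials `p_λ` and `s p_μ(s - 1)` of degree at most `D`. -/
def IsExplicitPoly (D : ℤ) (q : ℤ[X]) : Prop :=
  (∃ (r : ℕ) (lam : Fin r → ℕ), Antitone lam ∧ 2 * (r : ℤ) ≤ D ∧ q = p lam) ∨
  (∃ (r : ℕ) (mu : Fin r → ℕ), Antitone mu ∧ 2 * (r : ℤ) + 1 ≤ D ∧ q = X * (p mu).comp (X - 1))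

lemma IsExplicitPoly.eval_nonneg {D : ℤ} {q : ℤ[X]} (hq : IsExplicitPoly D q) {t : ℤ}
    (ht : 0 ≤ t) : 0 ≤ q.eval t := by
  rcases hq with ⟨r, lam, -, -, rfl⟩ | ⟨r, mu, -, -, rfl⟩
  · exact eval_p_nonneg lam t
  · rw [eval_mul, eval_X]
    refine mul_nonneg ht ?_
    rw [eval_comp]
    exact eval_p_nonneg mu _

/-- The zeros of `p_λ` are simple. -/
lemma exists_p_eq_prod {r : ℕ} {lam : Fin r → ℕ} (hlam : Antitone lam) :
    ∃ s : Finset ℕ, s.card = 2 * r ∧ p lam = ∏ c ∈ s, (X - C (c : ℤ)) := by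
  classical
  let f : Fin r × Fin 2 → ℕ := fun x => lam x.1.rev + 2 * x.1 + x.2
  have hlt : ∀ i k : Fin r, i < k → lam i.rev + 2 * i + 1 < lam k.rev + 2 * k := by
    intro i k hik
    have := hlam (Fin.rev_le_rev.2 hik.le)
    have : (i : ℕ) < k := hik
    omega
  have hf : Function.Injective f := by
    rintro ⟨i, b⟩ ⟨k, c⟩ h
    simp only [f] at h
    rcases lt_trichotomy i k with hik | rfl | hik
    · have := hlt i k hik
      omega
    · exact Prod.ext rfl (Fin.ext (by simpa using h))
    · have := hlt k i hik
      omega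
  refine ⟨Finset.univ.image f, ?_, ?_⟩
  · rw [Finset.card_image_of_injective _ hf]
    simp [mul_comm]
  · rw [Finset.prod_image hf.injOn, Fintype.prod_prod_type, p]
    refine Finset.prod_congr rfl fun i _ => ?_
    rw [Fin.prod_univ_two]
    simp [f]

/-- The explicit polynomials are products of distinct linear factors with roots in `ℕ`. -/
lemma IsExplicitPoly.exists_eq_prod {D : ℤ} {q : ℤ[X]} (hq : IsExplicitPoly D q) :
    ∃ s : Finset ℕ, (s.card : ℤ) ≤ D ∧ q = ∏ c ∈ s, (X - C (c : ℤ)) := by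
  classical
  rcases hq with ⟨r, lam, hlam, hr, rfl⟩ | ⟨r, mu, hmu, hr, rfl⟩
  · obtain ⟨s, hs, e⟩ := exists_p_eq_prod hlam
    exact ⟨s, by rw [hs]; push_cast; exact hr, e⟩
  · obtain ⟨s, hs, e⟩ := exists_p_eq_prod hmu
    have hinj : Function.Injective (· + 1 : ℕ → ℕ) := add_left_injective 1
    have h0 : 0 ∉ s.image (· + 1) := by simp
    refine ⟨insert 0 (s.image (· + 1)), ?_, ?_⟩
    · rw [Finset.card_insert_of_notMem h0, Finset.card_image_of_injective _ hinj, hs]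
      push_cast
      exact hr
    · rw [Finset.prod_insert h0, Finset.prod_image hinj.injOn, e, prod_comp]
      congr 1
      · simp
      · refine Finset.prod_congr rfl fun c _ => ?_
        rw [sub_comp, X_comp, C_comp]
        push_cast
        rw [C_add, C_1]
        ring

/-- A rational polynomial that vanishes at the zeros of a product of distinct linear factors is
divisible by it. -/
lemma prod_X_sub_C_dvd_of_eval_eq_zero (s : Finset ℤ) (P : ℚ[X])
    (h : ∀ c ∈ s, P.eval (c : ℚ) = 0) : ∏ c ∈ s, (X - C (c : ℚ)) ∣ P := by
  refine Finset.prod_dvd_of_coprime (fun c _ c' _ hne => ?_) fun c hc => dvd_iff_isRoot.2 (h c hc)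
  exact pairwise_coprime_X_sub_C (s := fun c : ℤ => (c : ℚ)) Int.cast_injective hne

/-- A polynomial that is non-negative on `ℕ` dominates a positive multiple of any non-negative
polynomial of at most the same degree that vanishes at its zeros. -/
lemma exists_pos_mul_le {P Q : ℚ[X]} (hP0 : P ≠ 0) (hP : ∀ t : ℕ, 0 ≤ P.eval (t : ℚ))
    (hQ : ∀ t : ℕ, 0 ≤ Q.eval (t : ℚ)) (hdeg : Q.natDegree ≤ P.natDegree)
    (hz : ∀ t : ℕ, P.eval (t : ℚ) = 0 → Q.eval (t : ℚ) = 0) :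
    ∃ ε : ℚ, 0 < ε ∧ ∀ t : ℕ, ε * Q.eval (t : ℚ) ≤ P.eval (t : ℚ) := by
  have hlc := leadingCoeff_pos_of_eval_nonneg hP0 0 fun j _ => hP j
  -- a factor for large arguments
  obtain ⟨ε₀, hε₀, N, hN⟩ : ∃ ε₀ : ℚ, 0 < ε₀ ∧ ∃ N : ℕ, ∀ t : ℕ, N ≤ t →
      ε₀ * Q.eval (t : ℚ) ≤ P.eval (t : ℚ) := by
    set ε₀ : ℚ := P.leadingCoeff / (2 * (|Q.coeff P.natDegree| + 1)) with hε
    have hε₀ : 0 < ε₀ := by positivity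
    have hc : 0 < (P - C ε₀ * Q).coeff P.natDegree := by
      rw [coeff_sub, coeff_C_mul, coeff_natDegree, sub_pos]
      calc ε₀ * Q.coeff P.natDegree ≤ ε₀ * (|Q.coeff P.natDegree| + 1) :=
            mul_le_mul_of_nonneg_left ((le_abs_self _).trans (by linarith)) hε₀.le
        _ = P.leadingCoeff / 2 := by
            rw [hε]
            have : |Q.coeff P.natDegree| + 1 ≠ 0 := by positivity
            field_simp
        _ < P.leadingCoeff := by linarith
    have hle : (P - C ε₀ * Q).natDegree ≤ P.natDegree :=
      (natDegree_sub_le _ _).trans (max_le le_rfl ((natDegree_C_mul_le _ _).trans hdeg))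
    have hnd := le_antisymm hle (le_natDegree_of_ne_zero hc.ne')
    obtain ⟨N, hN⟩ := exists_eval_pos_of_leadingCoeff_pos (P := P - C ε₀ * Q) (by
      rw [leadingCoeff, hnd]; exact hc)
    refine ⟨ε₀, hε₀, N, fun t ht => ?_⟩
    have := hN t ht
    rw [eval_sub, eval_mul, eval_C] at this
    linarith
  -- a factor for the remaining finitely many arguments
  have hfin : ∀ M : ℕ, ∃ ε : ℚ, 0 < ε ∧ ∀ t : ℕ, t < M → ε * Q.eval (t : ℚ) ≤ P.eval (t : ℚ) := by
    intro M
    induction M with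
    | zero => exact ⟨1, one_pos, fun t ht => absurd ht (Nat.not_lt_zero t)⟩
    | succ M ih =>
      obtain ⟨ε, hε, h⟩ := ih
      obtain ⟨ε', hε', h'⟩ : ∃ ε' : ℚ, 0 < ε' ∧ ε' * Q.eval (M : ℚ) ≤ P.eval (M : ℚ) := by
        rcases (hP M).lt_or_eq with hpos | h0
        · refine ⟨P.eval (M : ℚ) / (Q.eval (M : ℚ) + 1), div_pos hpos (by linarith [hQ M]), ?_⟩
          rw [div_mul_eq_mul_div, div_le_iff₀ (by linarith [hQ M])]
          nlinarith [hQ M]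
        · exact ⟨1, one_pos, by rw [hz M h0.symm, mul_zero]; exact hP M⟩
      refine ⟨min ε ε', lt_min hε hε', fun t ht => ?_⟩
      rcases Nat.lt_succ_iff_lt_or_eq.1 ht with h1 | rfl
      · exact (mul_le_mul_of_nonneg_right (min_le_left _ _) (hQ t)).trans (h t h1)
      · exact (mul_le_mul_of_nonneg_right (min_le_right _ _) (hQ t)).trans h'
  obtain ⟨ε, hε, h⟩ := hfin N
  refine ⟨min ε ε₀, lt_min hε hε₀, fun t => ?_⟩
  rcases Nat.lt_or_ge t N with h1 | h1
  · exact (mul_le_mul_of_nonneg_right (min_le_left _ _) (hQ t)).trans (h t h1)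
  · exact (mul_le_mul_of_nonneg_right (min_le_right _ _) (hQ t)).trans (hN t h1)

/-! ### The cone cut out by the inequalities -/

/-- The cone in `V_{n,a}` defined by the inequalities `T[h](j) ≥ 0`. -/
def cone (n : ℕ) (a : ℤ) : Set (V n a) := {h | ∀ j, 0 ≤ T n (h : ℕ → ℚ) j}

lemma IsHilbertPoly.mem_degreeLT {n : ℕ} {a : ℤ} (ha : -(n : ℤ) ≤ a) {h : V n a} {q : ℚ[X]}
    (hq : IsHilbertPoly a (h : ℕ → ℚ) q) : q ∈ degreeLT ℚ n := by
  obtain ⟨q', hq', e⟩ := (mem_V_iff ha _).1 h.2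
  convert! hq'
  refine eq_of_eventually_eval_eq (a + 1).toNat fun j hj => ?_
  rw [hq j (by omega)]
  have := e j (by omega)
  rw [extZ_natCast] at this
  exact_mod_cast this.symm

/-- The Hilbert polynomial of a nonzero element of the cone has positive leading coefficient, since
`T` multiplies the leading coefficient by a positive number. -/
lemma leadingCoeff_pos_of_mem_cone {n : ℕ} {a : ℤ} (ha : -(n : ℤ) ≤ a) {h : V n a}
    (hh : h ∈ cone n a) {q : ℚ[X]} (hq : IsHilbertPoly a (h : ℕ → ℚ) q) (h0 : q ≠ 0) :
    0 < q.leadingCoeff := by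
  have hdeg := hq.mem_degreeLT ha
  obtain ⟨hne, hlc⟩ := tPoly_natDegree_leadingCoeff hdeg h0
  have hpos := leadingCoeff_pos_of_eval_nonneg hne (a + 1).toNat fun j hj => by
    have e1 := hq j (by omega)
    have e2 := hq (j + 1) (by push_cast; omega)
    push_cast at e2
    rw [eval_tPoly, e1, e2]
    exact hh j
  rw [hlc] at hpos
  have hlt := natDegree_lt_of_mem_degreeLT hdeg h0
  refine pos_of_mul_pos_right hpos ?_
  rw [sub_nonneg]
  exact_mod_cast hlt.le

/-- The limiting inequality is a consequence of the others. -/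
lemma cone_eq_inter {n : ℕ} {a : ℤ} (ha : -(n : ℤ) ≤ a) :
    cone n a = (⋂ j : ℕ, {h : V n a |
        ((n : ℚ) + j + 1) * (h : ℕ → ℚ) j ≥ ((j : ℚ) + 1) * (h : ℕ → ℚ) (j + 1)}) ∩
      {h : V n a | ∃ q : ℚ[X], IsHilbertPoly a (h : ℕ → ℚ) q ∧ 0 ≤ q.coeff (n - 1)} := by
  ext h
  simp only [Set.mem_inter_iff, Set.mem_iInter, Set.mem_ofPred_eq]
  constructor
  · intro hh
    refine ⟨fun j => sub_nonneg.1 (hh j), ?_⟩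
    obtain ⟨q, hq, e⟩ := (mem_V_iff ha _).1 h.2
    have hqh : IsHilbertPoly a (h : ℕ → ℚ) q := fun j hj => by
      have := e j hj
      rw [extZ_natCast] at this
      exact_mod_cast this
    refine ⟨q, hqh, ?_⟩
    by_cases h0 : q = 0
    · rw [h0, coeff_zero]
    · have hlt := natDegree_lt_of_mem_degreeLT hq h0
      rcases (show q.natDegree ≤ n - 1 by omega).lt_or_eq with h1 | h1
      · rw [coeff_eq_zero_of_natDegree_lt h1]
      · rw [← h1]
        exact (leadingCoeff_pos_of_mem_cone ha hh hqh h0).le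
  · rintro ⟨hh, -⟩ j
    exact sub_nonneg.2 (hh j)

/-- The factor independent of the degree in `T` of the Hilbert function of
`S/⟨x₀, …, x_{c-1}⟩^(J+1)`, see `T_headFun`. -/
def headWeight (c J : ℕ) : ℚ := ((J : ℚ) + c) * (c + J - 1).choose J

lemma headWeight_pos {c : ℕ} (hc : 0 < c) (J : ℕ) : 0 < headWeight c J := by
  have : 0 < (c + J - 1).choose J := Nat.choose_pos (by omega)
  rw [headWeight]
  positivity

/-- The image under `T` of the Hilbert function of `S/𝔪^(J+1)` is concentrated in degree `J`. -/
lemma T_headFun_top (n J j : ℕ) :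
    T n (headFun n (n + 1) J) j = if j = J then headWeight (n + 1) J else 0 := by
  rw [T_headFun le_rfl]
  rcases lt_trichotomy j J with h | rfl | h
  · rw [if_neg (by omega), if_neg h.ne]
  · simp [headWeight]
  · rw [if_pos h.le, if_neg h.ne', Nat.choose_eq_zero_of_lt
      (show n + 1 - (n + 1) + (j - J) - 1 < j - J by omega), Nat.cast_zero, mul_zero]

lemma T_headFun_sub {n i : ℕ} (hi : i < n) (J j : ℕ) :
    T n (headFun n (n - i) J) j =
      if J ≤ j then headWeight (n - i) J * (j - J + i).choose i else 0 := by
  rw [T_headFun (by omega), ← Nat.choose_symm_add,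
    show n + 1 - (n - i) + (j - J) - 1 = j - J + i by omega]
  rfl

/-- Every element of the cone has a positive multiple that is the Hilbert function of a direct sum
of quotients `S/⟨x₀, …, x_{c-1}⟩^(J+1)`: below some large degree `J`, the values of `T[h]` are
realized by the `S/𝔪^i`, and from `J` on `T[h]` is a non-negative combination of the truncated
binomial coefficients that belong to `1 ≤ c ≤ n`. -/
lemma exists_isTorsionHilbertFunction_of_mem_cone (𝕜 : Type u) [Field 𝕜] {n : ℕ} {a : ℤ}
    (ha : -(n : ℤ) ≤ a) {h : V n a} (hh : h ∈ cone n a) :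
    ∃ N : ℕ, 0 < N ∧ IsTorsionHilbertFunction 𝕜 n ((N : ℚ) • (h : ℕ → ℚ)) := by
  obtain ⟨P, hP, e⟩ := (mem_V_iff ha _).1 (T_mem_V ha h.2)
  have he : ∀ j : ℕ, (a + 1).toNat ≤ j → P.eval (j : ℚ) = T n (h : ℕ → ℚ) j := by
    intro j hj
    have := e j (by omega)
    rw [extZ_natCast] at this
    exact_mod_cast this
  have hpos : P = 0 ∨ 0 < P.leadingCoeff := by
    by_cases h0 : P = 0
    · exact Or.inl h0
    · exact Or.inr (leadingCoeff_pos_of_eval_nonneg h0 (a + 1).toNat fun j hj => by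
        rw [he j hj]; exact hh j)
  obtain ⟨J₀, hJ₀⟩ := exists_binomial_expansion n P hP hpos
  set J := max J₀ (a + 1).toNat with hJ
  obtain ⟨c, hc, hce⟩ := hJ₀ J (le_max_left _ _)
  let U : ℕ ⊕ ℕ → ℕ → ℚ :=
    Sum.elim (fun j => headFun n (n + 1) j) (fun i => headFun n (n - i) J)
  let coef : ℕ ⊕ ℕ → ℚ := Sum.elim (fun j => T n (h : ℕ → ℚ) j / headWeight (n + 1) j)
    (fun i => c i / headWeight (n - i) J)
  let s : Finset (ℕ ⊕ ℕ) := (Finset.range J).disjSum (Finset.range n)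
  have hs : ∀ x ∈ s, (∃ j, x = Sum.inl j) ∨ ∃ i < n, x = Sum.inr i := by
    rintro (j | i) hx
    · exact Or.inl ⟨j, rfl⟩
    · exact Or.inr ⟨i, Finset.mem_range.1 (Finset.inr_mem_disjSum.1 hx), rfl⟩
  have hcoef : ∀ x ∈ s, 0 ≤ coef x := by
    intro x hx
    rcases hs x hx with ⟨j, rfl⟩ | ⟨i, hi, rfl⟩
    · exact div_nonneg (hh j) (headWeight_pos (Nat.succ_pos n) j).le
    · exact div_nonneg (hc i) (headWeight_pos (Nat.sub_pos_of_lt hi) J).le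
  have hU : ∀ x ∈ s, IsTorsionHilbertFunction 𝕜 n (U x) := by
    intro x hx
    rcases hs x hx with ⟨j, rfl⟩ | ⟨i, hi, rfl⟩
    · exact isTorsionHilbertFunction_headFun 𝕜 n (Nat.succ_pos n) j
    · exact isTorsionHilbertFunction_headFun 𝕜 n (Nat.sub_pos_of_lt hi) J
  have hUpoly : ∀ x ∈ s, U x ∈ eventuallyPoly n := by
    intro x hx
    rcases hs x hx with ⟨j, rfl⟩ | ⟨i, hi, rfl⟩
    · exact headFun_mem_eventuallyPoly (Nat.succ_pos n) le_rfl j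
    · exact headFun_mem_eventuallyPoly (Nat.sub_pos_of_lt hi) (by omega) J
  have hsum : ∑ x ∈ s, coef x • U x = (h : ℕ → ℚ) := by
    rw [← sub_eq_zero]
    refine eq_zero_of_T_eq_zero (n := n) (sub_mem (sum_mem fun x hx =>
      Submodule.smul_mem _ _ (hUpoly x hx)) (V_le_eventuallyPoly ha h.2)) ?_
    rw [map_sub, sub_eq_zero, map_sum]
    funext j
    rw [Finset.sum_apply, Finset.sum_disjSum]
    simp only [map_smul, Pi.smul_apply, smul_eq_mul, U, coef, Sum.elim_inl, Sum.elim_inr]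
    have e1 : ∑ k ∈ Finset.range J, T n (h : ℕ → ℚ) k / headWeight (n + 1) k *
        T n (headFun n (n + 1) k) j = if j < J then T n (h : ℕ → ℚ) j else 0 := by
      have : ∀ k ∈ Finset.range J, T n (h : ℕ → ℚ) k / headWeight (n + 1) k *
          T n (headFun n (n + 1) k) j = if j = k then T n (h : ℕ → ℚ) k else 0 := by
        intro k _
        have := (headWeight_pos (Nat.succ_pos n) k).ne'
        rw [T_headFun_top]
        split_ifs
        · field_simp
        · rw [mul_zero]
      rw [Finset.sum_congr rfl this, Finset.sum_ite_eq]
      simp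
    have e2 : ∑ i ∈ Finset.range n, c i / headWeight (n - i) J *
        T n (headFun n (n - i) J) j = if J ≤ j then T n (h : ℕ → ℚ) j else 0 := by
      have : ∀ i ∈ Finset.range n, c i / headWeight (n - i) J *
          T n (headFun n (n - i) J) j = if J ≤ j then c i * ((j - J + i).choose i : ℚ) else 0 := by
        intro i hi
        rw [Finset.mem_range] at hi
        have := (headWeight_pos (Nat.sub_pos_of_lt hi) J).ne'
        rw [T_headFun_sub hi]
        split_ifs
        · field_simp
        · rw [mul_zero]
      rw [Finset.sum_congr rfl this]
      split_ifs with hj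
      · rw [← hce j hj, he j (le_trans (le_max_right _ _) hj)]
      · exact Finset.sum_const_zero
    rw [e1, e2]
    by_cases hj : j < J
    · rw [if_pos hj, if_neg (not_le.2 hj), add_zero]
    · rw [if_neg hj, if_pos (not_lt.1 hj), zero_add]
  obtain ⟨N, hN, hNh⟩ := exists_isTorsionHilbertFunction_nsmul s coef U hcoef hU
  rw [hsum] at hNh
  exact ⟨N, hN, hNh⟩

/-- The closed convex hull of the Hilbert functions is the cone `T[h] ≥ 0`. -/
lemma Q_eq_cone (𝕜 : Type u) [Field 𝕜] {n : ℕ} {a : ℤ} (ha : -(n : ℤ) ≤ a) :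
    Q 𝕜 n a = cone n a := by
  apply Set.Subset.antisymm
  · refine closedConvexHull_min ?_ ?_ ?_
    · intro h hh j
      exact hh.deficiency_nonneg j
    · intro x hx y hy α β hα hβ _ j
      have : T n ((α • x + β • y : V n a) : ℕ → ℚ) j =
          α * T n (x : ℕ → ℚ) j + β * T n (y : ℕ → ℚ) j := by
        simp [map_add, map_smul]
      rw [this]
      exact add_nonneg (mul_nonneg hα (hx j)) (mul_nonneg hβ (hy j))
    · have : cone n a = ⋂ j : ℕ, {h : V n a | 0 ≤ ((n : ℚ) + j + 1) * (h : ℕ → ℚ) j -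
          ((j : ℚ) + 1) * (h : ℕ → ℚ) (j + 1)} := by
        ext h
        simp only [Set.mem_iInter]
        rfl
      rw [this]
      refine isClosed_iInter fun j => isClosed_le continuous_const ?_
      have hev : ∀ i : ℕ, Continuous fun h : V n a => (h : ℕ → ℚ) i := fun i =>
        (continuous_apply i).comp continuous_subtype_val
      exact (continuous_const.mul (hev j)).sub (continuous_const.mul (hev (j + 1)))
  · intro h hh
    obtain ⟨N, hN, hNh⟩ := exists_isTorsionHilbertFunction_of_mem_cone 𝕜 ha hh
    have h1 : (N : ℚ) • h ∈ Q 𝕜 n a :=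
      subset_closedConvexHull hNh.isHilbertFunction
    have h0 : (0 : V n a) ∈ Q 𝕜 n a :=
      subset_closedConvexHull (isTorsionHilbertFunction_zero 𝕜 n).isHilbertFunction
    have hN' : (0 : ℚ) < N := by exact_mod_cast hN
    have hN1 : (1 : ℚ) ≤ N := by exact_mod_cast hN
    have hconv : Convex ℚ (Q 𝕜 n a) := convex_closedConvexHull
    have := hconv h1 h0 (a := (N : ℚ)⁻¹) (b := 1 - (N : ℚ)⁻¹) (by positivity)
      (sub_nonneg.2 (inv_le_one_of_one_le₀ hN1)) (by ring)
    rwa [smul_zero, add_zero, smul_smul, inv_mul_cancel₀ hN'.ne', one_smul] at this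

/-! ### The explicit series -/

lemma aHat_cases (a : ℤ) : (0 ≤ a ∧ aHat a = a + 1) ∨ (a < 0 ∧ aHat a = 0) := by
  rw [aHat]
  omega

/-- The polynomial `∏_{ℓ=1}^{â-a-1} (s + ℓ)`, whose zeros are the negative integers greater
than `a`. -/
def weightPoly (a : ℤ) : ℚ[X] :=
  ∏ c ∈ (Finset.Icc 1 (aHat a - a - 1)).image (fun l => -l), (X - C (c : ℚ))

lemma eval_weightPoly (a j : ℤ) :
    (weightPoly a).eval (j : ℚ) = ((∏ l ∈ Finset.Icc 1 (aHat a - a - 1), (j + l) : ℤ) : ℚ) := by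
  rw [weightPoly, Finset.prod_image neg_injective.injOn, eval_prod]
  push_cast
  refine Finset.prod_congr rfl fun l _ => ?_
  rw [eval_sub, eval_X, eval_C, sub_neg_eq_add]

lemma natDegree_weightPoly (a : ℤ) : ((weightPoly a).natDegree : ℤ) = aHat a - a - 1 := by
  rw [weightPoly, natDegree_finsetProd_X_sub_C_eq_card, Finset.card_image_of_injective _
    neg_injective, Int.card_Icc]
  rcases aHat_cases a with h | h <;> omega

lemma weightPoly_ne_zero (a : ℤ) : weightPoly a ≠ 0 := (monic_prod_X_sub_C _ _).ne_zero

lemma eval_weightPoly_eq_zero {a j : ℤ} (h1 : a < j) (h2 : j < 0) :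
    (weightPoly a).eval (j : ℚ) = 0 := by
  rw [eval_weightPoly, Finset.prod_eq_zero (i := -j), Int.cast_zero]
  · rw [Finset.mem_Icc]
    rcases aHat_cases a with h | h <;> omega
  · omega

lemma eval_weightPoly_pos (a : ℤ) (j : ℕ) : 0 < (weightPoly a).eval (j : ℚ) := by
  have := eval_weightPoly a j
  rw [Int.cast_natCast] at this
  rw [this]
  have hpos : 0 < ∏ l ∈ Finset.Icc 1 (aHat a - a - 1), ((j : ℤ) + l) := by
    refine Finset.prod_pos fun l hl => ?_
    rw [Finset.mem_Icc] at hl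
    omega
  exact_mod_cast hpos

/-- The series with coefficients `q(j - â) ∏_{ℓ=1}^{â-a-1} (j + ℓ)` for `j ≥ â`. -/
def polySeries (a : ℤ) (q : ℤ[X]) : ℕ → ℚ := fun j =>
  if aHat a ≤ (j : ℤ) then
    ((q.eval ((j : ℤ) - aHat a) : ℤ) : ℚ) * (weightPoly a).eval (j : ℚ) else 0

lemma mem_explicitSeries_iff {n : ℕ} {a : ℤ} {F : ℕ → ℚ} :
    F ∈ explicitSeries n a ↔
      ∃ q, IsExplicitPoly (n - aHat a + a) q ∧ F = polySeries a q := by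
  have heven : ∀ {r : ℕ} (lam : Fin r → ℕ), seriesEven a lam = polySeries a (p lam) := by
    intro r lam
    funext j
    have := eval_weightPoly a j
    rw [Int.cast_natCast] at this
    rw [seriesEven, polySeries, this]
    split_ifs
    · push_cast; ring
    · rfl
  have hodd : ∀ {r : ℕ} (mu : Fin r → ℕ),
      seriesOdd a mu = polySeries a (X * (p mu).comp (X - 1)) := by
    intro r mu
    funext j
    have := eval_weightPoly a j
    rw [Int.cast_natCast] at this
    rw [seriesOdd, polySeries, this, eval_mul, eval_X, eval_comp, eval_sub, eval_X, eval_one]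
    split_ifs
    · push_cast; ring
    · rfl
  constructor
  · rintro (⟨r, lam, hlam, hr, rfl⟩ | ⟨r, mu, hmu, hr, rfl⟩)
    · exact ⟨_, Or.inl ⟨r, lam, hlam, by omega, rfl⟩, heven lam⟩
    · exact ⟨_, Or.inr ⟨r, mu, hmu, by omega, rfl⟩, hodd mu⟩
  · rintro ⟨_, ⟨r, lam, hlam, hr, rfl⟩ | ⟨r, mu, hmu, hr, rfl⟩, rfl⟩
    · exact Or.inl ⟨r, lam, hlam, by omega, (heven lam).symm⟩
    · exact Or.inr ⟨r, mu, hmu, by omega, (hodd mu).symm⟩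

/-- Over `ℚ`, an explicit polynomial is monic, of degree at most `D`, non-negative on `ℕ`, and
divides every polynomial that vanishes at its natural zeros, since these are all its roots and are
simple. -/
lemma IsExplicitPoly.map_spec {D : ℤ} {q : ℤ[X]} (hq : IsExplicitPoly D q) :
    (q.map (Int.castRingHom ℚ)).Monic ∧ ((q.map (Int.castRingHom ℚ)).natDegree : ℤ) ≤ D ∧
    (∀ t : ℕ, 0 ≤ (q.map (Int.castRingHom ℚ)).eval (t : ℚ)) ∧
    ∀ P : ℚ[X], (∀ t : ℕ, (q.map (Int.castRingHom ℚ)).eval (t : ℚ) = 0 → P.eval (t : ℚ) = 0) →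
      q.map (Int.castRingHom ℚ) ∣ P := by
  classical
  obtain ⟨s, hs, e⟩ := hq.exists_eq_prod
  have hmap : q.map (Int.castRingHom ℚ) =
      ∏ c ∈ s.image (fun c : ℕ => (c : ℤ)), (X - C (c : ℚ)) := by
    rw [e, Polynomial.map_prod, Finset.prod_image Nat.cast_injective.injOn]
    refine Finset.prod_congr rfl fun c _ => ?_
    simp
  refine ⟨?_, ?_, fun t => ?_, fun P hP => ?_⟩
  · rw [hmap]; exact monic_prod_X_sub_C _ _
  · rw [hmap, natDegree_finsetProd_X_sub_C_eq_card,
      Finset.card_image_of_injective _ Nat.cast_injective]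
    exact hs
  · rw [← Int.cast_natCast, eval_intCast_map]
    exact Int.cast_nonneg (hq.eval_nonneg (Int.natCast_nonneg t))
  · rw [hmap]
    refine prod_X_sub_C_dvd_of_eval_eq_zero _ P fun c hc => ?_
    obtain ⟨t, ht, rfl⟩ := Finset.mem_image.1 hc
    rw [Int.cast_natCast]
    refine hP t ?_
    rw [hmap, eval_prod]
    exact Finset.prod_eq_zero hc (by simp)

lemma polySeries_add {a : ℤ} (q : ℤ[X]) {j t : ℕ} (h : (j : ℤ) = t + aHat a) :
    polySeries a q j = (q.map (Int.castRingHom ℚ)).eval (t : ℚ) * (weightPoly a).eval (j : ℚ) := by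
  have := eval_intCast_map (Int.castRingHom ℚ) q (t : ℤ)
  rw [Int.cast_natCast] at this
  rw [polySeries, if_pos (by omega), this, show (j : ℤ) - aHat a = t by omega]
  rfl

lemma polySeries_mem_V {n : ℕ} {a : ℤ} (ha : -(n : ℤ) ≤ a) {q : ℤ[X]}
    (hq : IsExplicitPoly (n - aHat a + a) q) : polySeries a q ∈ V n a := by
  obtain ⟨-, hdeg, -, -⟩ := hq.map_spec
  refine (mem_V_iff ha _).2
    ⟨(q.map (Int.castRingHom ℚ)).comp (X - C ((aHat a : ℤ) : ℚ)) * weightPoly a, ?_, fun j hj => ?_⟩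
  · rw [mem_degreeLT_iff_coeff]
    intro m hm
    refine coeff_eq_zero_of_natDegree_lt (lt_of_le_of_lt natDegree_mul_le ?_)
    rw [natDegree_comp, natDegree_X_sub_C, mul_one]
    have := natDegree_weightPoly a
    omega
  · rw [eval_mul]
    rcases lt_or_ge j 0 with h | h
    · rw [eval_weightPoly_eq_zero hj h, mul_zero, extZ_of_neg _ h]
    · obtain ⟨k, rfl⟩ := Int.eq_ofNat_of_zero_le h
      obtain ⟨t, ht⟩ := Int.eq_ofNat_of_zero_le (show 0 ≤ (k : ℤ) - aHat a by
        rcases aHat_cases a with h | h <;> omega)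
      rw [extZ_natCast, polySeries_add q (show (k : ℤ) = t + aHat a by omega), eval_comp, eval_sub,
        eval_X, eval_C, ← Int.cast_sub, ht, Int.cast_natCast, Int.cast_natCast]

/-- For `f ∈ V_{n,a}` the values at `j ≥ â` are those of a polynomial of degree at most `n - â + a`
in `j - â`, multiplied with the weight. -/
lemma exists_weightPoly_factor {n : ℕ} {a : ℤ} (ha : -(n : ℤ) ≤ a) {f : ℕ → ℚ} (hf : f ∈ V n a) :
    ∃ R : ℚ[X], (R ≠ 0 → (R.natDegree : ℤ) ≤ n - aHat a + a) ∧ ∀ j t : ℕ, (j : ℤ) = t + aHat a →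
      f j = R.eval (t : ℚ) * (weightPoly a).eval (j : ℚ) := by
  obtain ⟨P, hP, e⟩ := (mem_V_iff ha f).1 hf
  obtain ⟨R, hR⟩ : weightPoly a ∣ P := by
    refine prod_X_sub_C_dvd_of_eval_eq_zero _ P fun c hc => ?_
    obtain ⟨l, hl, rfl⟩ := Finset.mem_image.1 hc
    rw [Finset.mem_Icc] at hl
    rw [e _ (by rcases aHat_cases a with h | h <;> omega), extZ_of_neg _ (by omega)]
  refine ⟨R.comp (X + C ((aHat a : ℤ) : ℚ)), fun h0 => ?_, fun j t hj => ?_⟩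
  · have hR0 : R ≠ 0 := by rintro rfl; exact h0 zero_comp
    have hlt := natDegree_lt_of_mem_degreeLT hP (by
      rw [hR]; exact mul_ne_zero (weightPoly_ne_zero a) hR0)
    rw [hR, natDegree_mul (weightPoly_ne_zero a) hR0] at hlt
    have := natDegree_weightPoly a
    rw [natDegree_comp, natDegree_X_add_C, mul_one]
    omega
  · have h1 := e j (by rcases aHat_cases a with h | h <;> omega)
    rw [extZ_natCast, Int.cast_natCast, hR, eval_mul] at h1
    have h2 : (t : ℚ) + ((aHat a : ℤ) : ℚ) = (j : ℚ) := by exact_mod_cast hj.symm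
    rw [← h1, eval_comp, eval_add, eval_X, eval_C, h2, mul_comm]

/-! ### Extreme rays -/

lemma headFun_mem_V {n : ℕ} {a : ℤ} (ha : -(n : ℤ) ≤ a) {J : ℕ} (hJ : (J : ℤ) ≤ a) :
    headFun n (n + 1) J ∈ V n a := by
  refine (mem_V_iff ha _).2 ⟨0, zero_mem _, fun j hj => ?_⟩
  obtain ⟨k, rfl⟩ := Int.eq_ofNat_of_zero_le (show 0 ≤ j by omega)
  rw [eval_zero, extZ_natCast, headFun_apply le_rfl (show J ≤ k by omega), Finset.sum_eq_zero]
  intro l hl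
  rw [Finset.mem_range] at hl
  rw [Nat.choose_eq_zero_of_lt (show n + 1 - (n + 1) + (k - l) - 1 < k - l by omega),
    Nat.cast_zero, mul_zero]

lemma mem_rayGenerators_iff {𝕜 : Type u} [Field 𝕜] {n : ℕ} {a : ℤ} {g : V n a} :
    g ∈ rayGenerators 𝕜 n a ↔
      (∃ J : ℕ, (J : ℤ) ≤ a ∧ (g : ℕ → ℚ) = headFun n (n + 1) J) ∨
      ∃ q, IsExplicitPoly (n - aHat a + a) q ∧ T n (g : ℕ → ℚ) = polySeries a q := by
  rw [rayGenerators, Set.mem_union, Set.mem_ofPred_eq, Set.mem_ofPred_eq, mem_explicitSeries_iff]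
  refine or_congr_left ⟨?_, ?_⟩
  · rintro ⟨i, h1, h2, e⟩
    obtain ⟨J, rfl⟩ : ∃ J, i = J + 1 := ⟨i - 1, by omega⟩
    exact ⟨J, by push_cast at h2; omega, by rw [e, hilbertFunPower_succ]⟩
  · rintro ⟨J, hJ, e⟩
    exact ⟨J + 1, by omega, by push_cast; omega, by rw [e, hilbertFunPower_succ]⟩

lemma T_coe_smul {n : ℕ} {a : ℤ} (c : ℚ) (g : V n a) (j : ℕ) :
    T n ((c • g : V n a) : ℕ → ℚ) j = c * T n (g : ℕ → ℚ) j := by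
  simp [map_smul]

lemma mem_ray_of_T_eq {n : ℕ} {a : ℤ} (ha : -(n : ℤ) ≤ a) {g x : V n a} {c : ℚ} (hc : 0 ≤ c)
    (h : ∀ j, T n (x : ℕ → ℚ) j = c * T n (g : ℕ → ℚ) j) : x ∈ ray g :=
  ⟨c, hc, T_injective_V ha (funext fun j => by rw [h, T_coe_smul])⟩

lemma rayGenerators_subset_cone {𝕜 : Type u} [Field 𝕜] {n : ℕ} {a : ℤ} {g : V n a}
    (hg : g ∈ rayGenerators 𝕜 n a) : g ∈ cone n a := by
  intro j
  rcases mem_rayGenerators_iff.1 hg with ⟨J, -, e⟩ | ⟨q, hq, e⟩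
  · rw [e, T_headFun_top]
    split_ifs
    · exact (headWeight_pos (Nat.succ_pos n) J).le
    · exact le_rfl
  · rw [e, polySeries]
    split_ifs with h
    · exact mul_nonneg (Int.cast_nonneg (hq.eval_nonneg (by omega))) (eval_weightPoly_pos a j).le
    · exact le_rfl

lemma rayGenerators_ne_zero {𝕜 : Type u} [Field 𝕜] {n : ℕ} {a : ℤ} {g : V n a}
    (hg : g ∈ rayGenerators 𝕜 n a) : g ≠ 0 := by
  rintro rfl
  have h0 : T n ((0 : V n a) : ℕ → ℚ) = 0 := by simp
  rcases mem_rayGenerators_iff.1 hg with ⟨J, -, e⟩ | ⟨q, hq, e⟩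
  · rw [e] at h0
    have := congrFun h0 J
    rw [T_headFun_top, if_pos rfl] at this
    exact (headWeight_pos (Nat.succ_pos n) J).ne' this
  · rw [h0] at e
    obtain ⟨hmon, -, -, -⟩ := hq.map_spec
    refine hmon.ne_zero (eq_of_eventually_eval_eq 0 fun t _ => ?_)
    obtain ⟨j, hj⟩ := Int.eq_ofNat_of_zero_le (show 0 ≤ (t : ℤ) + aHat a by
      rcases aHat_cases a with h | h <;> omega)
    have h1 := congrFun e j
    rw [polySeries_add q hj.symm] at h1
    rw [eval_zero]
    exact (mul_eq_zero.1 h1.symm).resolve_right (eval_weightPoly_pos a j).ne'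

/-- An element of the cone that is dominated by a multiple of a listed generator lies on its ray. In
the polynomial case it has at least the same zeros and at most the same degree. -/
lemma mem_ray_of_T_le {𝕜 : Type u} [Field 𝕜] {n : ℕ} {a : ℤ} (ha : -(n : ℤ) ≤ a) {g x : V n a}
    (hg : g ∈ rayGenerators 𝕜 n a) (hx : x ∈ cone n a) {K : ℚ}
    (h : ∀ j, T n (x : ℕ → ℚ) j ≤ K * T n (g : ℕ → ℚ) j) : x ∈ ray g := by
  rcases mem_rayGenerators_iff.1 hg with ⟨J, -, e⟩ | ⟨q, hq, e⟩
  · have hpos := headWeight_pos (Nat.succ_pos n) J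
    refine mem_ray_of_T_eq ha (c := T n (x : ℕ → ℚ) J / headWeight (n + 1) J)
      (div_nonneg (hx J) hpos.le) fun j => ?_
    have hj := h j
    rw [e, T_headFun_top] at hj ⊢
    split_ifs at hj ⊢ with h1
    · rw [h1, div_mul_cancel₀ _ hpos.ne']
    · rw [mul_zero] at hj ⊢
      exact le_antisymm hj (hx j)
  · obtain ⟨hmon, hdeg, hnn, hdvd⟩ := hq.map_spec
    set Q := q.map (Int.castRingHom ℚ) with hQ
    obtain ⟨R, -, hR⟩ := exists_weightPoly_factor ha (T_mem_V ha x.2)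
    have hidx : ∀ t : ℕ, ∃ j : ℕ, (j : ℤ) = t + aHat a := fun t => by
      obtain ⟨j, hj⟩ := Int.eq_ofNat_of_zero_le (show 0 ≤ (t : ℤ) + aHat a by
        rcases aHat_cases a with h | h <;> omega)
      exact ⟨j, hj.symm⟩
    have hR0 : ∀ t : ℕ, 0 ≤ R.eval (t : ℚ) := by
      intro t
      obtain ⟨j, hj⟩ := hidx t
      have := hx j
      rw [hR j t hj] at this
      exact nonneg_of_mul_nonneg_left this (eval_weightPoly_pos a j)
    have hRK : ∀ t : ℕ, R.eval (t : ℚ) ≤ K * Q.eval (t : ℚ) := by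
      intro t
      obtain ⟨j, hj⟩ := hidx t
      have := h j
      rw [hR j t hj, e, polySeries_add q hj, ← mul_assoc] at this
      exact le_of_mul_le_mul_right this (eval_weightPoly_pos a j)
    -- `R` is a constant multiple of `Q`
    obtain ⟨c, hc⟩ : ∃ c : ℚ, R = Q * C c := by
      by_cases hRz : R = 0
      · exact ⟨0, by rw [hRz, C_0, mul_zero]⟩
      obtain ⟨u, hu⟩ := hdvd R fun t ht => le_antisymm (by
        have := hRK t
        rwa [ht, mul_zero] at this) (hR0 t)
      have hu0 : u ≠ 0 := by rintro rfl; exact hRz (by rw [hu, mul_zero])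
      have hle := (natDegree_le_of_eval_le (P := C K * Q) hRz 0 (fun t _ => hR0 t) fun t _ => by
        rw [eval_mul, eval_C]; exact hRK t).trans (natDegree_C_mul_le _ _)
      rw [hu, natDegree_mul hmon.ne_zero hu0] at hle
      refine ⟨u.coeff 0, ?_⟩
      rw [hu, ← eq_C_of_natDegree_eq_zero (by omega)]
    have hTg : ∀ j : ℕ, T n (x : ℕ → ℚ) j = c * T n (g : ℕ → ℚ) j := by
      intro j
      rcases lt_or_ge (j : ℤ) (aHat a) with hlt | hge
      · have hgj : T n (g : ℕ → ℚ) j = 0 := by rw [e, polySeries, if_neg (by omega)]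
        have := h j
        rw [hgj, mul_zero] at this ⊢
        exact le_antisymm this (hx j)
      · obtain ⟨t, ht⟩ := Int.eq_ofNat_of_zero_le (show 0 ≤ (j : ℤ) - aHat a by omega)
        have hj : (j : ℤ) = t + aHat a := by omega
        rw [hR j t hj, e, polySeries_add q hj, hc, eval_mul, eval_C]
        ring
    have hc0 : 0 ≤ c := by
      obtain ⟨t, ht⟩ := exists_eval_pos_of_leadingCoeff_pos (P := Q) (by
        rw [hmon.leadingCoeff]; exact one_pos)
      have h1 := hR0 t
      rw [hc, eval_mul, eval_C] at h1
      exact nonneg_of_mul_nonneg_right h1 (ht t le_rfl)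
    exact mem_ray_of_T_eq ha hc0 hTg

/-- Every nonzero element of the cone dominates a positive multiple of a listed generator: either
`T[x]` is positive in some degree at most `a`, or the partitions provide an explicit series. -/
lemma exists_generator_le (𝕜 : Type u) [Field 𝕜] {n : ℕ} {a : ℤ} (ha : -(n : ℤ) ≤ a) {x : V n a}
    (hx : x ∈ cone n a) (hx0 : x ≠ 0) :
    ∃ g ∈ rayGenerators 𝕜 n a, ∃ ε : ℚ, 0 < ε ∧
      ∀ j, ε * T n (g : ℕ → ℚ) j ≤ T n (x : ℕ → ℚ) j := by
  by_cases hlow : ∃ J : ℕ, (J : ℤ) ≤ a ∧ T n (x : ℕ → ℚ) J ≠ 0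
  · obtain ⟨J, hJ, hne⟩ := hlow
    have hpos : 0 < T n (x : ℕ → ℚ) J := lt_of_le_of_ne (hx J) hne.symm
    have hw := headWeight_pos (Nat.succ_pos n) J
    refine ⟨⟨headFun n (n + 1) J, headFun_mem_V ha hJ⟩,
      mem_rayGenerators_iff.2 (Or.inl ⟨J, hJ, rfl⟩), T n (x : ℕ → ℚ) J / headWeight (n + 1) J,
      div_pos hpos hw, fun j => ?_⟩
    rw [T_headFun_top]
    split_ifs with h
    · rw [h, div_mul_cancel₀ _ hw.ne']
    · rw [mul_zero]; exact hx j
  · have hzero : ∀ j : ℕ, (j : ℤ) < aHat a → T n (x : ℕ → ℚ) j = 0 := by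
      intro j hj
      by_contra hne
      refine hlow ⟨j, ?_, hne⟩
      rcases aHat_cases a with h | h <;> omega
    obtain ⟨R, hRdeg, hR⟩ := exists_weightPoly_factor ha (T_mem_V ha x.2)
    have hR0 : ∀ t : ℕ, 0 ≤ R.eval (t : ℚ) := by
      intro t
      obtain ⟨j, hj⟩ := Int.eq_ofNat_of_zero_le (show 0 ≤ (t : ℤ) + aHat a by
        rcases aHat_cases a with h | h <;> omega)
      have := hx j
      rw [hR j t hj.symm] at this
      exact nonneg_of_mul_nonneg_left this (eval_weightPoly_pos a j)
    have hRne : R ≠ 0 := by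
      rintro rfl
      refine hx0 (Subtype.ext (eq_zero_of_T_eq_zero (V_le_eventuallyPoly ha x.2) ?_))
      funext j
      rcases lt_or_ge (j : ℤ) (aHat a) with hlt | hge
      · exact hzero j hlt
      · obtain ⟨t, ht⟩ := Int.eq_ofNat_of_zero_le (show 0 ≤ (j : ℤ) - aHat a by omega)
        rw [hR j t (by omega), eval_zero, zero_mul]
        rfl
    -- the explicit polynomial with the zeros of `R`
    have hreal : ∀ j : ℤ, 0 ≤ j → (R.map (algebraMap ℚ ℝ)).eval (j : ℝ) =
        ((R.eval (j.toNat : ℚ) : ℚ) : ℝ) := by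
      intro j hj
      obtain ⟨k, rfl⟩ := Int.eq_ofNat_of_zero_le hj
      have := eval_natCast_map (algebraMap ℚ ℝ) R k
      rw [Int.cast_natCast, this, Int.toNat_natCast]
      rfl
    obtain ⟨q, hq, hqz⟩ : ∃ q, IsExplicitPoly (R.natDegree : ℤ) q ∧
        ∀ t : ℕ, R.eval (t : ℚ) = 0 → q.eval (t : ℤ) = 0 := by
      have hmapz : ∀ t : ℕ, R.eval (t : ℚ) = 0 →
          (R.map (algebraMap ℚ ℝ)).eval (((t : ℤ)) : ℝ) = 0 := by
        intro t ht
        rw [hreal t (Int.natCast_nonneg t), Int.toNat_natCast, ht, Rat.cast_zero]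
      rcases exists_partition_of_eval_nonneg R.natDegree (R.map (algebraMap ℚ ℝ)) 0
        natDegree_map_le ((Polynomial.map_ne_zero_iff (algebraMap ℚ ℝ).injective).2 hRne)
        (fun j hj => by rw [hreal j hj]; exact Rat.cast_nonneg.2 (hR0 _)) with
        ⟨r, lam, hlam, hr, hz⟩ | ⟨r, mu, hmu, hr, hz⟩
      · rw [natDegree_map] at hr
        refine ⟨p lam, Or.inl ⟨r, lam, hlam, by exact_mod_cast hr, rfl⟩, fun t ht => ?_⟩
        have := hz t (Int.natCast_nonneg t) (hmapz t ht)
        rwa [sub_zero] at this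
      · rw [natDegree_map] at hr
        refine ⟨_, Or.inr ⟨r, mu, hmu, by exact_mod_cast hr, rfl⟩, fun t ht => ?_⟩
        have := hz t (Int.natCast_nonneg t) (hmapz t ht)
        rw [sub_zero] at this
        rw [eval_mul, eval_X, eval_comp, eval_sub, eval_X, eval_one]
        exact this
    obtain ⟨-, hdegQ, hQ0, -⟩ := hq.map_spec
    obtain ⟨ε, hε, hle⟩ := exists_pos_mul_le hRne hR0 hQ0 (by exact_mod_cast hdegQ) (by
      intro t ht
      rw [← Int.cast_natCast, eval_intCast_map, Int.cast_id, hqz t ht, map_zero])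
    have hq' : IsExplicitPoly (n - aHat a + a) q := by
      have := hRdeg hRne
      rcases hq with ⟨r, lam, h1, h2, h3⟩ | ⟨r, mu, h1, h2, h3⟩
      · exact Or.inl ⟨r, lam, h1, h2.trans this, h3⟩
      · exact Or.inr ⟨r, mu, h1, h2.trans this, h3⟩
    obtain ⟨g, hg, -⟩ := existsUnique_T_eq ha (polySeries_mem_V ha hq')
    refine ⟨g, mem_rayGenerators_iff.2 (Or.inr ⟨q, hq', hg⟩), ε, hε, fun j => ?_⟩
    rw [hg]
    rcases lt_or_ge (j : ℤ) (aHat a) with hlt | hge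
    · rw [hzero j hlt, polySeries, if_neg (by omega), mul_zero]
    · obtain ⟨t, ht⟩ := Int.eq_ofNat_of_zero_le (show 0 ≤ (j : ℤ) - aHat a by omega)
      have hj : (j : ℤ) = t + aHat a := by omega
      rw [hR j t hj, polySeries_add q hj, ← mul_assoc]
      exact mul_le_mul_of_nonneg_right (hle t) (eval_weightPoly_pos a j).le

lemma isExtremeRay_iff (𝕜 : Type u) [Field 𝕜] {n : ℕ} {a : ℤ} (ha : -(n : ℤ) ≤ a)
    (R : Set (V n a)) :
    IsExtremeRay (cone n a) R ↔ R ∈ ray '' rayGenerators 𝕜 n a := by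
  constructor
  · rintro ⟨⟨v, hv0, rfl⟩, hext⟩
    have hv : v ∈ cone n a := hext.subset ⟨1, zero_le_one, (one_smul ℚ v).symm⟩
    obtain ⟨g, hg, ε, hε, hle⟩ := exists_generator_le 𝕜 ha hv hv0
    -- `v` is the midpoint of `2εg` and `2(v - εg)`
    have h1 : ((2 * ε) • g : V n a) ∈ cone n a := fun j => by
      rw [T_coe_smul]
      exact mul_nonneg (by positivity) (rayGenerators_subset_cone hg j)
    have h2 : ((2 : ℚ) • (v - ε • g) : V n a) ∈ cone n a := fun j => by
      have : T n ((v - ε • g : V n a) : ℕ → ℚ) j =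
          T n (v : ℕ → ℚ) j - ε * T n (g : ℕ → ℚ) j := by
        simp [map_sub, map_smul]
      rw [T_coe_smul, this]
      exact mul_nonneg zero_le_two (sub_nonneg.2 (hle j))
    obtain ⟨c, hc, e⟩ := hext.left_mem_of_mem_openSegment h1 h2
      (show v ∈ ray v from ⟨1, zero_le_one, (one_smul ℚ v).symm⟩)
      ⟨1 / 2, 1 / 2, by norm_num, by norm_num, by norm_num, by
        rw [smul_smul, smul_smul, show 1 / 2 * (2 * ε) = ε by ring,
          show (1 / 2 * 2 : ℚ) = 1 by norm_num, one_smul, add_sub_cancel]⟩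
    have hε2 : (2 * ε) ≠ 0 := by positivity
    have hc0 : c ≠ 0 := by
      rintro rfl
      rw [zero_smul] at e
      exact rayGenerators_ne_zero hg ((smul_eq_zero.1 e).resolve_left hε2)
    refine ⟨g, hg, Set.Subset.antisymm ?_ ?_⟩
    · rintro _ ⟨d, hd, rfl⟩
      refine ⟨d * ((2 * ε)⁻¹ * c), by positivity, ?_⟩
      rw [mul_smul, mul_smul, ← e, smul_smul (2 * ε)⁻¹, inv_mul_cancel₀ hε2, one_smul]
    · rintro _ ⟨d, hd, rfl⟩
      refine ⟨d * (c⁻¹ * (2 * ε)), by positivity, ?_⟩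
      rw [mul_smul, mul_smul, e, smul_smul c⁻¹, inv_mul_cancel₀ hc0, one_smul]
  · rintro ⟨g, hg, rfl⟩
    refine ⟨⟨g, rayGenerators_ne_zero hg, rfl⟩, ?_, ?_⟩
    · rintro _ ⟨c, hc, rfl⟩ j
      rw [T_coe_smul]
      exact mul_nonneg hc (rayGenerators_subset_cone hg j)
    · rintro x hx y hy z ⟨c, hc, rfl⟩ ⟨α, β, hα, hβ, -, e⟩
      refine mem_ray_of_T_le ha hg hx (K := c / α) fun j => ?_
      have h1 : α * T n (x : ℕ → ℚ) j + β * T n (y : ℕ → ℚ) j = c * T n (g : ℕ → ℚ) j := by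
        rw [← T_coe_smul c, ← e]
        simp [map_add, map_smul]
      have h2 := mul_nonneg hβ.le (hy j)
      rw [div_mul_eq_mul_div, le_div_iff₀ hα]
      linarith

end

end HilbertCone

theorem mainTheorem5 (𝕜 : Type u) [Field 𝕜] (n : ℕ) (a : ℤ) (ha : -(n : ℤ) ≤ a) :
    -- the cone is the intersection of the half-spaces, including the limiting one
    (HilbertCone.Q 𝕜 n a =
      (⋂ j : ℕ, {h : HilbertCone.V n a |
        ((n : ℚ) + j + 1) * (h : ℕ → ℚ) j ≥ ((j : ℚ) + 1) * (h : ℕ → ℚ) (j + 1)}) ∩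
      {h : HilbertCone.V n a | ∃ q : ℚ[X],
        HilbertCone.IsHilbertPoly a (h : ℕ → ℚ) q ∧ 0 ≤ q.coeff (n - 1)}) ∧
    -- nonzero Hilbert polynomials have positive leading coefficient
    (∀ h ∈ HilbertCone.Q 𝕜 n a, ∀ q : ℚ[X], HilbertCone.IsHilbertPoly a (h : ℕ → ℚ) q →
      q ≠ 0 → 0 < q.leadingCoeff) ∧
    -- the listed generators exist in `V_{n,a}`, and the inverse images are unique there
    (∀ i : ℕ, 1 ≤ i → (i : ℤ) ≤ a + 1 →
      HilbertCone.hilbertFunPower 𝕜 n i ∈ HilbertCone.V n a) ∧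
    (∀ F ∈ HilbertCone.explicitSeries n a,
      ∃! g : HilbertCone.V n a, HilbertCone.T n (g : ℕ → ℚ) = F) ∧
    -- the extreme rays are exactly the rays spanned by the listed generators
    {R : Set (HilbertCone.V n a) | HilbertCone.IsExtremeRay (HilbertCone.Q 𝕜 n a) R} =
      HilbertCone.ray '' HilbertCone.rayGenerators 𝕜 n a := by
  have hQ := HilbertCone.Q_eq_cone 𝕜 ha
  refine ⟨hQ.trans (HilbertCone.cone_eq_inter ha), fun h hh q hq h0 => ?_, fun i h1 h2 => ?_,
    fun F hF => ?_, ?_⟩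
  · exact HilbertCone.leadingCoeff_pos_of_mem_cone ha (hQ ▸ hh) hq h0
  · obtain ⟨J, rfl⟩ : ∃ J, i = J + 1 := ⟨i - 1, by omega⟩
    rw [HilbertCone.hilbertFunPower_succ]
    exact HilbertCone.headFun_mem_V ha (by push_cast at h2; omega)
  · obtain ⟨q, hq, rfl⟩ := HilbertCone.mem_explicitSeries_iff.1 hF
    exact HilbertCone.existsUnique_T_eq ha (HilbertCone.polySeries_mem_V ha hq)
  · ext R
    rw [Set.mem_ofPred_eq, hQ, HilbertCone.isExtremeRay_iff 𝕜 ha]
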